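/- **Setting.** Let $(X,\mathfrak M,\mu)$ be a measure space. A family $\mathfrak B\subset\mathfrak M$ of sets (called balls) is a *ball-basis* with constant $\mathcal K$ if: (B1) $0<\mu(B)<\infty$ for $B\in\mathfrak B$; (B2) any two points of $X$ lie in a common ball; (B3) for every $E\in\mathfrak M$ and $\varepsilon>0$ there is a countable (possibly finite) family of balls $B_k$ with $\mu(E\bigtriangleup\bigcup_kB_k)<\varepsilon$; (B4) to each ball $B$ a ball $B^*$ (its hull) is assigned which contains every ball $A$ with $\mu(A)\le2\mu(B)$, $A\cap B\ne\varnothing$, and which satisfies $\mu(B^*)\le\mathcal K\mu(B)$. Let $1\le r<\infty$; scalars are real or complex. For $f\in L^r(X)$ and a ball $B$ put $$\langle f\rangle_{B,r}=\Big(\frac1{\mu(B)}\int_B|f|^r\,d\mu\Big)^{1/r},\qquad \langle f\rangle^*_{B,r}=\sup_{A\in\mathfrak B,\,A\supset B}\langle f\rangle_{A,r}.$$ An operator $T$ assigns to each $f\in L^r(X)$ a function $Tf$ on $X$ (not necessarily measurable); it is *subadditive* if $|T(\lambda f)(x)|=|\lambda||Tf(x)|$ for $\lambda\in\mathbb R$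 and $|T(f+g)(x)|\le|Tf(x)|+|Tg(x)|$. Values are scalars, except that suprema of operators take values in $[0,\infty]$, with the convention $|\infty-\infty|=0$. With the conventions $0/0=0$ and $a/0=\infty$ for $a>0$, put $$\mathcal L_1(T)=\sup_{B\in\mathfrak B}\ \sup_{x,x'\in B,\ f\in L^r}\frac{|T(f\mathbf 1_{X\setminus B^*})(x)-T(f\mathbf 1_{X\setminus B^*})(x')|}{\langle f\rangle^*_{B,r}},$$ let $\mathcal L_2(T)$ be the infimum of the constants $L\in[0,\infty]$ such that for every ball $A$ with $A^*\ne X$ there is a ball $B\supsetneq A$ with $$\sup_{x\in A,\ f\in L^r}\frac{|T(f\mathbf 1_{B^*\setminus A^*})(x)|}{\langle f\rangle_{B^*,r}}\le L$$ ($\mathcal L_2(T)=\infty$ if there is no such $L$), and $$\|T\|_{L^r\to L^{r,\infty}}=\sup_{t>0,\ f\in L^r}\frac{t\,\mu^*\{|Tf|>t\}^{1/r}}{\|f\|_{L^r}},$$ where $\mu^*$ is the outer measure. $T$ is a *bounded oscillation* ($\mathrm{BO}$) operator if it is subadditive, $\mathcal L_1(T)<\infty$ and $\mathcal L_2(T)<\infty$.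 A collection $\mathcal S$ of balls is *$\gamma$-sparse* if there are pairwise disjoint measurable sets $E_B\subset B$, $B\in\mathcal S$, with $\mu(E_B)\ge\gamma\mu(B)$; and $\mathcal A_{\mathcal S,r}f=\sum_{A\in\mathcal S}\langle f\rangle_{A,r}\mathbf 1_A$. **Theorem.** For every $\mathcal K$ there are constants $C>0$ and $0<\gamma<1$, depending only on $\mathcal K$, such that for every measure space with a ball-basis with constant $\mathcal K$ and every $1\le r<\infty$ the following hold. (1) Let $\{T_\alpha\}$ be a family of $\mathrm{BO}$ operators such that $\sup_\alpha\mathcal L_1(T_\alpha)$, $\sup_\alpha\mathcal L_2(T_\alpha)$ and $\sup_\alpha\|T_\alpha\|_{L^r\to L^{r,\infty}}$ are finite. Then $Tf(x)=\sup_\alpha|T_\alpha f(x)|$ is a $\mathrm{BO}$ operator and $$\mathcal L_1(T)\le C\sup_\alpha\mathcal L_1(T_\alpha),\qquad \mathcal L_2(T)\le C\Big(\sup_\alpha\mathcal L_1(T_\alpha)+\sup_\alpha\mathcal L_2(T_\alpha)+\sup_\alpha\|T_\alpha\|_{L^r\to L^{r,\infty}}\Big).$$ (2) Let $T$ be a $\mathrm{BO}$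 operator with $\|T\|_{L^r\to L^{r,\infty}}<\infty$ and let $\mathcal G=\{g_\alpha\}\subset L^\infty(X)$ be a family with $\sup_\alpha\|g_\alpha\|_\infty<\infty$. Then the maximal modulation $T^{\mathcal G}f(x)=\sup_\alpha|T(g_\alpha f)(x)|$ is a $\mathrm{BO}$ operator, and for every $f\in L^r(X)$ and every ball $B$ there is a family of balls $\mathcal S$ which is a union of two $\gamma$-sparse collections and satisfies $$|T^{\mathcal G}f(x)|\le C\Big(\sup_\alpha\|g_\alpha\|_\infty\,\big(\mathcal L_1(T)+\mathcal L_2(T)\big)+\|T^{\mathcal G}\|_{L^r\to L^{r,\infty}}\Big)\,\mathcal A_{\mathcal S,r}f(x)\quad\text{for a.e. }x\in B.$$ -/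

import Mathlib

open MeasureTheory Set
open scoped ENNReal NNReal

noncomputable section

/-- `ℬ` is a ball-basis for the measure `μ`: the members of `ℬ` are the balls, `hull B` is the ball
`B^*` attached to `B`, and `K` is the constant with `μ(B^*) ≤ K μ(B)`. -/
structure IsBallBasis {X : Type*} [MeasurableSpace X] (μ : Measure X) (ℬ : Set (Set X))
    (hull : Set X → Set X) (K : ℝ≥0) : Prop where
  measurableSet : ∀ B ∈ ℬ, MeasurableSet B
  measure_pos : ∀ B ∈ ℬ, 0 < μ B
  measure_lt_top : ∀ B ∈ ℬ, μ B < ∞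
  exists_mem_mem : ∀ x y : X, ∃ B ∈ ℬ, x ∈ B ∧ y ∈ B
  approx : ∀ E : Set X, MeasurableSet E → ∀ ε : ℝ≥0∞, 0 < ε →
    ∃ 𝒞 : Set (Set X), 𝒞.Countable ∧ 𝒞 ⊆ ℬ ∧ μ (symmDiff E (⋃₀ 𝒞)) < ε
  hull_mem : ∀ B ∈ ℬ, hull B ∈ ℬ
  subset_hull : ∀ B ∈ ℬ, (⋃ A ∈ {A ∈ ℬ | μ A ≤ 2 * μ B ∧ (A ∩ B).Nonempty}, A) ⊆ hull B
  measure_hull_le : ∀ B ∈ ℬ, μ (hull B) ≤ K * μ B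

section Averages

variable {X 𝕜 : Type*} [MeasurableSpace X] [RCLike 𝕜]

/-- The average `⟨f⟩_{B,r}`. -/
def ballAvg (μ : Measure X) (r : ℝ) (f : X → 𝕜) (B : Set X) : ℝ≥0∞ :=
  ((μ B)⁻¹ * ∫⁻ x in B, ‖f x‖ₑ ^ r ∂μ) ^ (1 / r)

/-- The maximal average `⟨f⟩^*_{B,r}`, over all balls containing `B`. -/
def ballAvgStar (μ : Measure X) (ℬ : Set (Set X)) (r : ℝ) (f : X → 𝕜) (B : Set X) : ℝ≥0∞ :=
  ⨆ A ∈ {A ∈ ℬ | B ⊆ A}, ballAvg μ r f A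

/-- The operator `𝒜_{𝒮,r} f(x) = ∑_{A ∈ 𝒮} ⟨f⟩_{A,r} 1_A(x)`. -/
def sparseOp (μ : Measure X) (𝒮 : Set (Set X)) (r : ℝ) (f : X → 𝕜) (x : X) : ℝ≥0∞ :=
  ∑' A : 𝒮, (A : Set X).indicator (fun _ => ballAvg μ r f A) x

/-- A `γ`-sparse collection of sets. -/
def IsSparse (μ : Measure X) (γ : ℝ≥0) (𝒮 : Set (Set X)) : Prop :=
  ∃ E : Set X → Set X,
    (∀ B ∈ 𝒮, MeasurableSet (E B) ∧ E B ⊆ B ∧ (γ : ℝ≥0∞) * μ B ≤ μ (E B)) ∧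
    𝒮.PairwiseDisjoint E

end Averages

/- Operators `T : L^r(X) → L^0(X)`. An element of `L^r(X)` is represented by a function `f` with
`MemLp f (ENNReal.ofReal r) μ`, and `T f` may depend on the a.e.-class of `f` only. The values
`T f x` are taken in a type `V` which is either the scalar field `𝕜` (with the usual absolute value
`‖·‖ₑ` and distance `edist`) or, for suprema of operators, `[0,∞]`, where `‖a‖ₑ = a` and
`edist a b = |a - b|` with `|∞ - ∞| = 0` and `|∞ - a| = ∞` for finite `a`.
In `[0,∞]` quotients satisfy `0 / 0 = 0` and `a / 0 = ∞` for `a ≠ 0`. -/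
section Operators

variable {X 𝕜 V : Type*} [MeasurableSpace X] [RCLike 𝕜] [ENorm V]

structure IsSubadditive (μ : Measure X) (r : ℝ) (T : (X → 𝕜) → X → V) : Prop where
  congr_ae : ∀ f g : X → 𝕜, MemLp f (ENNReal.ofReal r) μ → MemLp g (ENNReal.ofReal r) μ →
    f =ᵐ[μ] g → T f = T g
  smul : ∀ (c : ℝ) (f : X → 𝕜), MemLp f (ENNReal.ofReal r) μ →
    ∀ x, ‖T (c • f) x‖ₑ = ‖c‖ₑ * ‖T f x‖ₑ
  add_le : ∀ f g : X → 𝕜, MemLp f (ENNReal.ofReal r) μ → MemLp g (ENNReal.ofReal r) μ →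
    ∀ x, ‖T (f + g) x‖ₑ ≤ ‖T f x‖ₑ + ‖T g x‖ₑ

/-- The weak-type norm `‖T‖_{L^r → L^{r,∞}}`. Here `μ` of a possibly non-measurable set is its outer
measure. -/
def weakNorm (μ : Measure X) (r : ℝ) (T : (X → 𝕜) → X → V) : ℝ≥0∞ :=
  ⨆ (t : ℝ≥0) (_ : 0 < t) (f : X → 𝕜) (_ : MemLp f (ENNReal.ofReal r) μ),
    ((t : ℝ≥0∞) * μ {x | (t : ℝ≥0∞) < ‖T f x‖ₑ} ^ (1 / r)) / eLpNorm f (ENNReal.ofReal r) μ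

/-- The localization constant `ℒ₁(T)`. -/
def localConst [EDist V] (μ : Measure X) (ℬ : Set (Set X)) (hull : Set X → Set X) (r : ℝ)
    (T : (X → 𝕜) → X → V) : ℝ≥0∞ :=
  ⨆ (B ∈ ℬ) (x ∈ B) (x' ∈ B) (f : X → 𝕜) (_ : MemLp f (ENNReal.ofReal r) μ),
    edist (T ((hull B)ᶜ.indicator f) x) (T ((hull B)ᶜ.indicator f) x') / ballAvgStar μ ℬ r f B

/-- `Δ_T(A, B)`: the supremum of `|T(f 1_{B^* \ A^*})(x)| / ⟨f⟩_{B^*,r}` over `x ∈ A`,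
`f ∈ L^r`. -/
def annulusConst (μ : Measure X) (hull : Set X → Set X) (r : ℝ)
    (T : (X → 𝕜) → X → V) (A B : Set X) : ℝ≥0∞ :=
  ⨆ (x ∈ A) (f : X → 𝕜) (_ : MemLp f (ENNReal.ofReal r) μ),
    ‖T ((hull B \ hull A).indicator f) x‖ₑ / ballAvg μ r f (hull B)

/-- The connectivity constant `ℒ₂(T)`: the infimum of the constants `L` such that every ball `A` with
`A^* ≠ X` is strictly contained in a ball `B` with `Δ_T(A, B) ≤ L`. -/
def connectConst (μ : Measure X) (ℬ : Set (Set X)) (hull : Set X → Set X) (r : ℝ)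
    (T : (X → 𝕜) → X → V) : ℝ≥0∞ :=
  sInf {L : ℝ≥0∞ | ∀ A ∈ ℬ, hull A ≠ univ → ∃ B ∈ ℬ, A ⊂ B ∧ annulusConst μ hull r T A B ≤ L}

/-- Bounded oscillation operators with respect to the ball-basis `ℬ`. -/
structure IsBO [EDist V] (μ : Measure X) (ℬ : Set (Set X)) (hull : Set X → Set X) (r : ℝ)
    (T : (X → 𝕜) → X → V) : Prop where
  subadditive : IsSubadditive μ r T
  localization : localConst μ ℬ hull r T < ∞
  connectivity : connectConst μ ℬ hull r T < ∞

/-- The operator `T f(x) = sup_α |T_α f(x)|`. -/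
def supOp {ι : Type*} (T : ι → (X → 𝕜) → X → V) (f : X → 𝕜) (x : X) : ℝ≥0∞ :=
  ⨆ α, ‖T α f x‖ₑ

/-- The maximal modulation `T^𝒢 f(x) = sup_α |T(g_α f)(x)|`. -/
def maxModulation {ι : Type*} (g : ι → X → 𝕜) (T : (X → 𝕜) → X → V) : (X → 𝕜) → X → ℝ≥0∞ :=
  supOp fun α f => T (g α * f)

end Operators

end

/-! The core is a stopping-time argument for a nonnegative subadditive operator T with all three
constants at most L. For a ball P let H P be its third hull and t_P = T(f 1_{H P}). Weak-type bounds
for T and for the maximal function confine the points where t_P or the averages of f 1_{H P} exceed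
a multiple of ⟨f⟩_{H P} to a set E_P with 4K³μ(E_P) ≤ μ(P). If H R ⊆ H P and no ball strictly larger
than the second hull of R is more than half filled by E_P, then t_P ≤ a_P + t_R on that second hull,
a_P being a multiple of ⟨f⟩_{H P}. This comes from `local_step`: connectivity handles an annulus
inside the hull of a larger ball B, and localization compares the rest with its value at a good
point of B.

Accordingly R is a ball through x, more than half filled by E_P and of nearly maximal measure. It
may meet other selected balls, so the parent P is the one, among those whose hull contains x, with
the smallest dense balls at x. Then R misses the core of every earlier ball, i.e. the ball minus the
hulls of its dense balls. Cores keep half the measure and are disjoint, which is sparsity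
(`exists_child`, `exists_next`). The bound on dense balls halves at each stage, while almost every
point lies in finitely many selected hulls. Hence some P has no dense ball at x, so x ∉ E_P and the
iteration closes (`exists_sparse_selection`).

For suprema, oscillation bounds pass to the supremum directly. The connecting balls depend on the
index, but one of nearly least measure serves all indices, the discrepancy being absorbed by
localization and weak type (`far_bound`). For modulations one connecting ball of T serves every g_α,
because multiplication by g_α enlarges averages by at most ‖g_α‖_∞. Thus `exists_sparse_domination`
applies to T^𝒢. -/

/-! ### Ball-bases: covering, density and exhaustion -/

section BallBasis

variable {X : Type*} [MeasurableSpace X] {μ : Measure X} {ℬ : Set (Set X)}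
  {hull : Set X → Set X} {K : ℝ≥0}

namespace IsBallBasis

lemma mono_const {K' : ℝ≥0} (h : IsBallBasis μ ℬ hull K) (hK : K ≤ K') :
    IsBallBasis μ ℬ hull K' :=
  { h with
    measure_hull_le := fun B hB => (h.measure_hull_le B hB).trans (by gcongr) }

lemma nonempty_ball (h : IsBallBasis μ ℬ hull K) {B : Set X} (hB : B ∈ ℬ) : B.Nonempty :=
  nonempty_of_measure_ne_zero (h.measure_pos B hB).ne'

lemma measure_ne_zero (h : IsBallBasis μ ℬ hull K) {B : Set X} (hB : B ∈ ℬ) : μ B ≠ 0 :=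
  (h.measure_pos B hB).ne'

lemma measure_ne_top (h : IsBallBasis μ ℬ hull K) {B : Set X} (hB : B ∈ ℬ) : μ B ≠ ∞ :=
  (h.measure_lt_top B hB).ne

lemma subset_hull_of_inter (h : IsBallBasis μ ℬ hull K) {A B : Set X} (hA : A ∈ ℬ) (hB : B ∈ ℬ)
    (hAB : μ A ≤ 2 * μ B) (hne : (A ∩ B).Nonempty) : A ⊆ hull B :=
  (subset_biUnion_of_mem (u := fun A : Set X => A)
    (show A ∈ {A ∈ ℬ | μ A ≤ 2 * μ B ∧ (A ∩ B).Nonempty} from ⟨hA, hAB, hne⟩)).trans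
    (h.subset_hull B hB)

lemma self_subset_hull (h : IsBallBasis μ ℬ hull K) {B : Set X} (hB : B ∈ ℬ) : B ⊆ hull B :=
  h.subset_hull_of_inter hB hB (by rw [two_mul]; exact le_self_add)
    (by simpa using h.nonempty_ball hB)

/-- The balls of a family whose measure is controlled by a finite measure `ν` have a union whose
measure is controlled by the total mass of `ν`. -/
lemma measure_sUnion_le (h : IsBallBasis μ ℬ hull K) {𝒞 : Set (Set X)} (h𝒞 : 𝒞 ⊆ ℬ)
    {ν : Measure X} (hν : ν univ ≠ ∞) {c : ℝ≥0∞} (hc : c ≠ ∞) (hle : ∀ D ∈ 𝒞, μ D ≤ c * ν D) :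
    μ (⋃₀ 𝒞) ≤ K * c * ν univ := by
  have : IsFiniteMeasure ν := ⟨hν.lt_top⟩
  have hfin : ∀ D ∈ 𝒞, μ D ≠ ∞ := fun D hD => h.measure_ne_top (h𝒞 hD)
  obtain ⟨u, hu𝒞, hdisj, hcov⟩ := Vitali.exists_disjoint_subfamily_covering_enlargement
    (fun D : Set X => D) 𝒞 (fun D => (μ D).toReal) 2 one_lt_two (fun _ _ => ENNReal.toReal_nonneg)
    (c * ν univ).toReal
    (fun D hD => ENNReal.toReal_mono (ENNReal.mul_ne_top hc hν)
      ((hle D hD).trans (by gcongr; exact subset_univ _)))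
    (fun D hD => h.nonempty_ball (h𝒞 hD))
  -- Disjoint sets of positive measure for a finite measure are countably many.
  have hpos : ∀ D ∈ u, 0 < ν D := fun D hD => by
    refine pos_iff_ne_zero.2 fun h0 => h.measure_ne_zero (h𝒞 (hu𝒞 hD)) ?_
    simpa [h0] using hle D (hu𝒞 hD)
  have hcount : u.Countable := by
    have := Measure.countable_meas_pos_of_disjoint_iUnion (μ := ν) (As := fun D : u => (D : Set X))
      (fun D => h.measurableSet _ (h𝒞 (hu𝒞 D.2)))
      (fun D D' hDD => hdisj D.2 D'.2 (fun e => hDD (Subtype.ext e)))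
    have huniv : {i : u | 0 < ν (i : Set X)} = univ := by
      ext i; simpa using hpos i i.2
    rw [huniv] at this
    exact countable_univ_iff.1 this |>.to_set
  have hsub : ⋃₀ 𝒞 ⊆ ⋃ D ∈ u, hull D := by
    rintro x ⟨D, hD, hx⟩
    obtain ⟨D', hD', hne, hm⟩ := hcov D hD
    refine mem_iUnion₂.2 ⟨D', hD', h.subset_hull_of_inter (h𝒞 hD) (h𝒞 (hu𝒞 hD')) ?_ hne hx⟩
    rw [← ENNReal.toReal_le_toReal (hfin D hD) (ENNReal.mul_ne_top (by simp) (hfin _ (hu𝒞 hD')))]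
    simpa using hm
  calc μ (⋃₀ 𝒞) ≤ μ (⋃ D ∈ u, hull D) := measure_mono hsub
    _ ≤ ∑' D : u, μ (hull D) := measure_biUnion_le μ hcount _
    _ ≤ ∑' D : u, K * c * ν D := by
        refine ENNReal.tsum_le_tsum fun D => ?_
        rw [mul_assoc]
        exact (h.measure_hull_le _ (h𝒞 (hu𝒞 D.2))).trans (by gcongr; exact hle _ (hu𝒞 D.2))
    _ = K * c * ∑' D : u, ν D := ENNReal.tsum_mul_left
    _ ≤ K * c * ν univ := by
        gcongr
        exact tsum_meas_le_meas_iUnion_of_disjoint₀ ν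
          (fun D => (h.measurableSet _ (h𝒞 (hu𝒞 D.2))).nullMeasurableSet)
          (fun D D' hDD => (hdisj D.2 D'.2 (fun e => hDD (Subtype.ext e))).aedisjoint)
          |>.trans (measure_mono (subset_univ _))

/-- Almost every point of a measurable set `E` lies in a ball more than half of which is in `E`. -/
lemma ae_exists_dense_ball (h : IsBallBasis μ ℬ hull K) {E : Set X} (hE : MeasurableSet E) :
    ∀ᵐ x ∂μ, x ∈ E → ∃ B ∈ ℬ, x ∈ B ∧ μ B < 2 * μ (B ∩ E) := by
  set N : Set X := {x | ¬ (x ∈ E → ∃ B ∈ ℬ, x ∈ B ∧ μ B < 2 * μ (B ∩ E))} with hN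
  change μ N = 0
  -- N need not be measurable, so a measurable F between N and E is approximated instead. A ball
  -- meeting N has at least half its measure off E, hence off F, that is, inside the approximation
  -- error.
  set F := toMeasurable μ N ∩ E with hF
  have hFm : MeasurableSet F := (measurableSet_toMeasurable _ _).inter hE
  have hNE : N ⊆ E := fun x hx => by
    by_contra hxE
    exact hx fun h' => absurd h' hxE
  have hNF : N ⊆ F := subset_inter (subset_toMeasurable _ _) hNE
  have key : ∀ ε : ℝ≥0, 0 < ε → μ N ≤ (1 + K * 2) * ε := by
    intro ε hε
    obtain ⟨𝒞, hcount, h𝒞, hlt⟩ := h.approx F hFm ε (by exact_mod_cast hε)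
    set 𝒞' := {D ∈ 𝒞 | (D ∩ N).Nonempty} with h𝒞'
    have hUm : MeasurableSet (⋃₀ 𝒞) :=
      MeasurableSet.sUnion hcount fun D hD => h.measurableSet D (h𝒞 hD)
    set ν := μ.restrict (⋃₀ 𝒞 \ F) with hν
    have hνu : ν univ ≤ ε := by
      rw [hν, Measure.restrict_apply_univ]
      exact (measure_mono subset_union_right).trans hlt.le
    have hle : ∀ D ∈ 𝒞', μ D ≤ 2 * ν D := by
      rintro D ⟨hD, x, hxD, hxN⟩
      have hDm := h.measurableSet D (h𝒞 hD)
      have hhalf : 2 * μ (D ∩ E) ≤ μ D := by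
        by_contra hcon
        exact hxN fun _ => ⟨D, h𝒞 hD, hxD, not_le.1 hcon⟩
      have hsplit : μ (D ∩ E) + μ (D \ E) = μ D := measure_inter_add_sdiff D hE
      have hfin : μ (D ∩ E) ≠ ∞ :=
        ((measure_mono inter_subset_left).trans_lt (h.measure_lt_top D (h𝒞 hD))).ne
      have h1 : μ (D ∩ E) ≤ μ (D \ E) := by
        rw [← hsplit, two_mul] at hhalf
        exact (ENNReal.add_le_add_iff_left hfin).1 hhalf
      have h2 : μ (D \ E) ≤ ν D := by
        rw [hν, Measure.restrict_apply hDm]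
        exact measure_mono fun x hx => ⟨hx.1, ⟨D, hD, hx.1⟩, fun hxF => hx.2 hxF.2⟩
      calc μ D = μ (D ∩ E) + μ (D \ E) := hsplit.symm
        _ ≤ ν D + ν D := add_le_add (h1.trans h2) h2
        _ = 2 * ν D := (two_mul _).symm
    have hcov := h.measure_sUnion_le (𝒞 := 𝒞') (fun D hD => h𝒞 hD.1) (ν := ν)
      (hνu.trans_lt ENNReal.coe_lt_top).ne (c := 2) (by simp) hle
    have hsub : N ⊆ (F \ ⋃₀ 𝒞) ∪ ⋃₀ 𝒞' := by
      intro x hx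
      by_cases hxU : x ∈ ⋃₀ 𝒞
      · obtain ⟨D, hD, hxD⟩ := hxU
        exact Or.inr ⟨D, ⟨hD, x, hxD, hx⟩, hxD⟩
      · exact Or.inl ⟨hNF hx, hxU⟩
    calc μ N ≤ μ (F \ ⋃₀ 𝒞) + μ (⋃₀ 𝒞') := (measure_mono hsub).trans (measure_union_le _ _)
      _ ≤ ε + K * 2 * ε := by
          gcongr
          · exact (measure_mono subset_union_left).trans hlt.le
          · exact hcov.trans (by gcongr)
      _ = (1 + K * 2) * ε := by ring
  by_contra hne
  have hpos : 0 < μ N := pos_iff_ne_zero.2 hne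
  have hc : (1 + K * 2 : ℝ≥0∞) ≠ ∞ := by finiteness
  have hc0 : (1 + K * 2 : ℝ≥0∞) ≠ 0 := by positivity
  obtain ⟨ε, hε, hlt⟩ := ENNReal.lt_iff_exists_nnreal_btwn.1
    (show 0 < μ N / (1 + K * 2) from ENNReal.div_pos hne hc)
  have h1 := key ε (by exact_mod_cast hε)
  rw [mul_comm] at h1
  exact absurd (ENNReal.div_le_of_le_mul h1) (not_le.2 hlt)

/-- An integrable amount of mass is caught up to a factor `2` by a ball containing a given one. -/
lemma exists_superset_lintegral_le (h : IsBallBasis μ ℬ hull K) {φ : X → ℝ≥0∞}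
    (hφ : ∫⁻ x, φ x ∂μ ≠ ∞) {B : Set X} (hB : B ∈ ℬ) :
    ∃ A ∈ ℬ, B ⊆ A ∧ ∫⁻ x, φ x ∂μ ≤ 2 * ∫⁻ x in A, φ x ∂μ := by
  obtain ⟨x₀, hx₀⟩ := h.nonempty_ball hB
  set S : Set ℝ≥0∞ := μ '' {D ∈ ℬ | x₀ ∈ D} with hS
  obtain ⟨u, -, hu, huS⟩ := exists_seq_tendsto_sSup (S := S) ⟨_, B, ⟨hB, hx₀⟩, rfl⟩ (OrderTop.bddAbove _)
  choose D hD hDu using huS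
  -- The D n pass through x₀ with measures tending to the supremum, so eventually any ball through
  -- x₀ has at most twice the measure of D n.
  have hcatch : ∀ D' ∈ ℬ, x₀ ∈ D' → ∀ᶠ n in Filter.atTop, D' ⊆ hull (D n) := by
    intro D' hD' hx'
    have hlt : μ D' / 2 < sSup S :=
      (ENNReal.half_lt_self (h.measure_ne_zero hD') (h.measure_ne_top hD')).trans_le
        (le_sSup ⟨D', ⟨hD', hx'⟩, rfl⟩)
    filter_upwards [hu.eventually (lt_mem_nhds hlt)] with n hn
    refine h.subset_hull_of_inter hD' (hD n).1 ?_ ⟨x₀, hx', (hD n).2⟩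
    rw [hDu, mul_comm]
    exact (ENNReal.div_le_iff_le_mul (by simp) (by simp)).1 hn.le
  -- The hulls need not increase; their tail intersections do, and exhaust X.
  set V : ℕ → Set X := fun n => ⋂ k ≥ n, hull (D k) with hV
  have hVmono : Monotone V := fun m n hmn => by
    intro x hx
    simp only [hV, mem_iInter] at hx ⊢
    exact fun k hk => hx k (hmn.trans hk)
  have hVu : ⋃ n, V n = univ := by
    refine eq_univ_of_forall fun y => ?_
    obtain ⟨D', hD', hx', hy'⟩ := h.exists_mem_mem x₀ y
    obtain ⟨n, hn⟩ := Filter.eventually_atTop.1 (hcatch D' hD' hx')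
    exact mem_iUnion.2 ⟨n, mem_iInter₂.2 fun k hk => hn k hk hy'⟩
  have hVm : ∀ n, MeasurableSet (V n) := fun n =>
    MeasurableSet.iInter fun k => MeasurableSet.iInter fun _ =>
      h.measurableSet _ (h.hull_mem _ (hD k).1)
  have hlim := tendsto_measure_iUnion_atTop (μ := μ.withDensity φ) hVmono
  rw [hVu, withDensity_apply _ MeasurableSet.univ, Measure.restrict_univ] at hlim
  by_cases h0 : ∫⁻ x, φ x ∂μ = 0
  · exact ⟨B, hB, subset_rfl, by simp [h0]⟩
  have hev := hlim.eventually (lt_mem_nhds (ENNReal.half_lt_self h0 hφ))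
  obtain ⟨n, hn, hBn⟩ := (hev.and (hcatch B hB hx₀)).exists
  refine ⟨hull (D n), h.hull_mem _ (hD n).1, hBn, ?_⟩
  rw [Function.comp_apply, withDensity_apply _ (hVm n)] at hn
  have hsub : V n ⊆ hull (D n) := iInter₂_subset n le_rfl
  rw [mul_comm]
  refine (ENNReal.div_le_iff_le_mul (by simp) (by simp)).1 (hn.le.trans ?_)
  exact lintegral_mono_set hsub

end IsBallBasis

end BallBasis

/-! ### Dense balls, cores and selection stages -/

section Selection

variable {X : Type*} [MeasurableSpace X] {μ : Measure X} {ℬ : Set (Set X)}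
  {hull : Set X → Set X} {K : ℝ≥0}

/-- The balls more than half of which is contained in `E`. -/
def denseBalls (μ : Measure X) (ℬ : Set (Set X)) (E : Set X) : Set (Set X) :=
  {B ∈ ℬ | μ B < 2 * μ (B ∩ E)}

/-- The supremum of the measures of the balls through `x` more than half of which is in `E`. -/
noncomputable def denseSup (μ : Measure X) (ℬ : Set (Set X)) (E : Set X) (x : X) : ℝ≥0∞ :=
  ⨆ B ∈ {B ∈ denseBalls μ ℬ E | x ∈ B}, μ B

/-- A measurable set containing the hulls of all balls more than half of which is in `E`. -/
noncomputable def denseHull (μ : Measure X) (ℬ : Set (Set X)) (hull : Set X → Set X) (E : Set X) :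
    Set X :=
  toMeasurable μ (⋃₀ (hull '' denseBalls μ ℬ E))

lemma denseSup_le (E : Set X) (x : X) : denseSup μ ℬ E x ≤ 2 * μ E :=
  iSup₂_le fun B hB => hB.1.2.le.trans (by gcongr; exact inter_subset_right)

lemma le_denseSup {E B : Set X} {x : X} (hB : B ∈ denseBalls μ ℬ E) (hx : x ∈ B) :
    μ B ≤ denseSup μ ℬ E x :=
  le_iSup₂_of_le B ⟨hB, hx⟩ le_rfl

lemma exists_of_lt_denseSup {E : Set X} {x : X} {c : ℝ≥0∞} (hc : c < denseSup μ ℬ E x) :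
    ∃ B ∈ denseBalls μ ℬ E, x ∈ B ∧ c < μ B := by
  obtain ⟨B, hB⟩ := lt_iSup_iff.1 hc
  obtain ⟨hB', hlt⟩ := lt_iSup_iff.1 hB
  exact ⟨B, hB'.1, hB'.2, hlt⟩

lemma hull_subset_denseHull {E B : Set X} (hB : B ∈ denseBalls μ ℬ E) :
    hull B ⊆ denseHull μ ℬ hull E :=
  (subset_sUnion_of_mem (mem_image_of_mem hull hB)).trans (subset_toMeasurable _ _)

namespace IsBallBasis

lemma measure_denseHull_le (h : IsBallBasis μ ℬ hull K) {E : Set X} (hE : μ E ≠ ∞) :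
    μ (denseHull μ ℬ hull E) ≤ K * (K * 2) * μ E := by
  rw [denseHull, measure_toMeasurable]
  have := h.measure_sUnion_le (𝒞 := hull '' denseBalls μ ℬ E)
    (by rintro _ ⟨B, hB, rfl⟩; exact h.hull_mem B hB.1) (ν := μ.restrict E) (c := K * 2)
    (by rwa [Measure.restrict_apply_univ]) (by finiteness) (by
      rintro _ ⟨B, hB, rfl⟩
      rw [mul_assoc, Measure.restrict_apply (h.measurableSet _ (h.hull_mem B hB.1))]
      refine (h.measure_hull_le B hB.1).trans ?_
      gcongr
      exact hB.2.le.trans (by gcongr; exact h.self_subset_hull hB.1))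
  rwa [Measure.restrict_apply_univ] at this

end IsBallBasis

/-- The sum of `a Q` over the members `Q` of `S` whose third hull contains `z`. -/
noncomputable def hullSum (hull : Set X → Set X) (a : Set X → ℝ≥0∞) (S : Set (Set X)) (z : X) :
    ℝ≥0∞ :=
  ∑' Q : Set X, S.indicator (fun Q => (hull (hull (hull Q))).indicator (fun _ => a Q) z) Q

omit [MeasurableSpace X] in
lemma hullSum_mono (a : Set X → ℝ≥0∞) {S S' : Set (Set X)} (hS : S ⊆ S') (z : X) :
    hullSum hull a S z ≤ hullSum hull a S' z :=
  ENNReal.tsum_le_tsum fun Q => indicator_le_indicator_of_subset hS (fun _ => zero_le) Q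

omit [MeasurableSpace X] in
-- A newly selected ball contributes a term not counted before; this pays for the extra a R in the
-- domination invariant.
lemma hullSum_add_le (a : Set X → ℝ≥0∞) {S S' : Set (Set X)} (hS : S ⊆ S') {R : Set X}
    (hR : R ∉ S) (hR' : R ∈ S') {z : X} (hz : z ∈ hull (hull (hull R))) :
    hullSum hull a S z + a R ≤ hullSum hull a S' z := by
  classical
  have h1 : a R = ∑' Q : Set X, if Q = R then a Q else 0 := (tsum_ite_eq R a).symm
  rw [h1, hullSum, hullSum, ← ENNReal.tsum_add]
  refine ENNReal.tsum_le_tsum fun Q => ?_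
  by_cases hQ : Q = R
  · subst hQ
    simp [hR, hR', hz]
  · simp only [hQ, if_false, add_zero]
    exact indicator_le_indicator_of_subset hS (fun _ => zero_le) Q

/-- An intermediate family in the selection of a sparse domination for the functions `t P`
(controlled on the second hull of `P`) with exceptional sets `E P` and coefficients `a P`. -/
structure SelectionStage (μ : Measure X) (ℬ : Set (Set X)) (hull : Set X → Set X)
    (E : Set X → Set X) (a : Set X → ℝ≥0∞) (t : Set X → X → ℝ≥0∞) (A : Set X) (j : ℕ)
    (S : Set (Set X)) : Prop where
  subset : S ⊆ ℬ
  root : A ∈ S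
  inside : ∀ P ∈ S, hull (hull (hull P)) ⊆ hull (hull (hull A))
  disj : S.PairwiseDisjoint fun P => P \ denseHull μ ℬ hull (E P)
  size : ∀ P ∈ S, μ A ≤ 2 ^ (j + 1) * μ P
  dom : ∀ P ∈ S, ∀ z ∈ hull (hull P), t A z + a P ≤ hullSum hull a S z + t P z
  cover : ∀ x ∈ hull A, ∃ P ∈ S, x ∈ hull P ∧ 2 ^ j * denseSup μ ℬ (E P) x ≤ μ A

section Stage

variable {E : Set X → Set X} {a : Set X → ℝ≥0∞} {t : Set X → X → ℝ≥0∞} {A : Set X}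

namespace IsBallBasis

/-- The removed set has measure at most 2K²μ(E P), which is at most half of μ P. -/
lemma measure_le_two_mul_core (h : IsBallBasis μ ℬ hull K) (hK : 1 ≤ K)
    (hE : ∀ P ∈ ℬ, 4 * K ^ 3 * μ (E P) ≤ μ P) {P : Set X} (hP : P ∈ ℬ) :
    μ P ≤ 2 * μ (P \ denseHull μ ℬ hull (E P)) := by
  have hK' : (1 : ℝ≥0∞) ≤ K := by exact_mod_cast hK
  have hEP : μ (E P) ≠ ∞ := by
    intro htop
    have := hE P hP
    rw [htop, ENNReal.mul_top (by positivity)] at this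
    exact h.measure_ne_top hP (top_le_iff.1 this)
  have hU : 2 * μ (denseHull μ ℬ hull (E P)) ≤ μ P := by
    calc 2 * μ (denseHull μ ℬ hull (E P)) ≤ 2 * (K * (K * 2) * μ (E P)) := by
          gcongr; exact h.measure_denseHull_le hEP
      _ = 4 * (K ^ 2) * μ (E P) := by ring
      _ ≤ 4 * K ^ 3 * μ (E P) := by
          gcongr
          norm_num
      _ ≤ μ P := hE P hP
  have hsplit : μ P ≤ μ (denseHull μ ℬ hull (E P)) + μ (P \ denseHull μ ℬ hull (E P)) :=
    (measure_mono (by intro x hx; by_cases hx' : x ∈ denseHull μ ℬ hull (E P) <;> simp [hx, hx'])).trans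
      (measure_union_le _ _)
  have h2 : μ P + μ P ≤ μ P + 2 * μ (P \ denseHull μ ℬ hull (E P)) := by
    calc μ P + μ P = 2 * μ P := (two_mul _).symm
      _ ≤ 2 * μ (denseHull μ ℬ hull (E P)) + 2 * μ (P \ denseHull μ ℬ hull (E P)) := by
          rw [← mul_add]; gcongr
      _ ≤ _ := by gcongr
  exact (ENNReal.add_le_add_iff_left (h.measure_ne_top hP)).1 h2

lemma measurableSet_core (h : IsBallBasis μ ℬ hull K) {P : Set X} (hP : P ∈ ℬ) :
    MeasurableSet (P \ denseHull μ ℬ hull (E P)) :=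
  (h.measurableSet P hP).diff (measurableSet_toMeasurable _ _)

lemma hull3_mem (h : IsBallBasis μ ℬ hull K) {P : Set X} (hP : P ∈ ℬ) :
    hull (hull (hull P)) ∈ ℬ := h.hull_mem _ (h.hull_mem _ (h.hull_mem _ hP))

lemma hull2_subset_hull3 (h : IsBallBasis μ ℬ hull K) {P : Set X} (hP : P ∈ ℬ) :
    hull (hull P) ⊆ hull (hull (hull P)) :=
  h.self_subset_hull (h.hull_mem _ (h.hull_mem _ hP))

lemma subset_hull2 (h : IsBallBasis μ ℬ hull K) {P : Set X} (hP : P ∈ ℬ) :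
    P ⊆ hull (hull P) :=
  (h.self_subset_hull hP).trans (h.self_subset_hull (h.hull_mem _ hP))

lemma measure_hull2_le (h : IsBallBasis μ ℬ hull K) {P : Set X} (hP : P ∈ ℬ) :
    μ (hull (hull P)) ≤ K ^ 2 * μ P :=
  (h.measure_hull_le _ (h.hull_mem _ hP)).trans
    ((mul_le_mul_right (h.measure_hull_le _ hP) _).trans (by rw [← mul_assoc, sq]))

lemma measure_hull3_le (h : IsBallBasis μ ℬ hull K) {P : Set X} (hP : P ∈ ℬ) :
    μ (hull (hull (hull P))) ≤ K ^ 3 * μ P :=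
  (h.measure_hull2_le (h.hull_mem _ hP)).trans
    ((mul_le_mul_right (h.measure_hull_le _ hP) _).trans (by rw [← mul_assoc, ← pow_succ]))

/-- The cores `P \ U` of a disjoint family inside a ball have summable measures. -/
lemma tsum_measure_le (h : IsBallBasis μ ℬ hull K) (hK : 1 ≤ K)
    (hE : ∀ P ∈ ℬ, 4 * K ^ 3 * μ (E P) ≤ μ P) {S : Set (Set X)} (hS : S ⊆ ℬ)
    (hdisj : S.PairwiseDisjoint fun P => P \ denseHull μ ℬ hull (E P)) {D : Set X}
    (hSD : ∀ P ∈ S, P ⊆ D) :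
    ∑' P : S, μ (P : Set X) ≤ 2 * μ D := by
  calc ∑' P : S, μ (P : Set X)
      ≤ ∑' P : S, 2 * μ ((P : Set X) \ denseHull μ ℬ hull (E P)) :=
        ENNReal.tsum_le_tsum fun P => h.measure_le_two_mul_core hK hE (hS P.2)
    _ = 2 * ∑' P : S, μ ((P : Set X) \ denseHull μ ℬ hull (E P)) := ENNReal.tsum_mul_left
    _ ≤ 2 * μ D := by
        gcongr
        exact (tsum_meas_le_meas_iUnion_of_disjoint μ
          (As := fun P : S => (P : Set X) \ denseHull μ ℬ hull (E P))
          (fun P => h.measurableSet_core (hS P.2))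
          (fun P P' hPP => hdisj P.2 P'.2 fun e => hPP (Subtype.ext e))).trans
          (measure_mono (iUnion_subset fun P => sdiff_subset.trans (hSD P P.2)))

end IsBallBasis

namespace SelectionStage

variable {j : ℕ} {S : Set (Set X)}

lemma subset_top (h : IsBallBasis μ ℬ hull K) (st : SelectionStage μ ℬ hull E a t A j S)
    {P : Set X} (hP : P ∈ S) : P ⊆ hull (hull (hull A)) :=
  ((h.subset_hull2 (st.subset hP)).trans (h.hull2_subset_hull3 (st.subset hP))).trans
    (st.inside P hP)

/-- The disjoint cores lie in one ball and each has measure at least μ A / 2^(j+2). Finiteness is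
what allows a parent to be chosen by minimality. -/
lemma finite (h : IsBallBasis μ ℬ hull K) (hK : 1 ≤ K)
    (hE : ∀ P ∈ ℬ, 4 * K ^ 3 * μ (E P) ≤ μ P) (st : SelectionStage μ ℬ hull E a t A j S) :
    S.Finite := by
  have hA := st.subset st.root
  have hfin := Measure.finite_const_le_meas_of_disjoint_iUnion μ (ε := μ A / 2 ^ (j + 2))
    (As := fun P : S => (P : Set X) \ denseHull μ ℬ hull (E P))
    (ENNReal.div_pos (h.measure_ne_zero hA) (by finiteness))
    (fun P => h.measurableSet_core (st.subset P.2))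
    (fun P P' hPP => st.disj P.2 P'.2 fun e => hPP (Subtype.ext e))
    ((measure_mono (iUnion_subset fun P => sdiff_subset.trans (st.subset_top h P.2))).trans_lt
      (h.measure_lt_top _ (h.hull3_mem hA))).ne
  have huniv : {i : S | μ A / 2 ^ (j + 2) ≤ μ ((i : Set X) \ denseHull μ ℬ hull (E i))} = univ := by
    refine eq_univ_of_forall fun P => ?_
    refine ENNReal.div_le_of_le_mul ?_
    calc μ A ≤ 2 ^ (j + 1) * μ (P : Set X) := st.size P P.2
      _ ≤ 2 ^ (j + 1) * (2 * μ ((P : Set X) \ denseHull μ ℬ hull (E P))) := by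
          gcongr; exact h.measure_le_two_mul_core hK hE (st.subset P.2)
      _ = _ := by ring
  rw [huniv] at hfin
  exact Set.finite_coe_iff.1 (Set.finite_univ_iff.1 hfin)

lemma init (h : IsBallBasis μ ℬ hull K) (hK : 1 ≤ K)
    (hE : ∀ P ∈ ℬ, 4 * K ^ 3 * μ (E P) ≤ μ P) (hA : A ∈ ℬ) :
    SelectionStage μ ℬ hull E a t A 0 {A} where
  subset := by simpa using hA
  root := rfl
  inside := by rintro _ rfl; rfl
  disj := pairwiseDisjoint_singleton _ _
  size := by
    rintro _ rfl
    rw [zero_add, pow_one, two_mul]; exact le_self_add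
  dom := by
    rintro _ rfl z hz
    rw [add_comm]
    gcongr
    refine le_trans ?_ (hullSum_add_le a (S := ∅) (empty_subset _) (notMem_empty _)
      (mem_singleton _) (h.hull2_subset_hull3 hA hz))
    exact le_add_self
  cover := by
    intro x hx
    refine ⟨A, rfl, hx, ?_⟩
    have hK' : (1 : ℝ≥0∞) ≤ K := by exact_mod_cast hK
    calc 2 ^ 0 * denseSup μ ℬ (E A) x ≤ 2 * μ (E A) := by
          rw [pow_zero, one_mul]; exact denseSup_le _ _
      _ ≤ 4 * K ^ 3 * μ (E A) := by
          gcongr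
          calc (2 : ℝ≥0∞) ≤ 4 * 1 := by norm_num
            _ ≤ 4 * K ^ 3 := by gcongr; exact one_le_pow₀ hK'
      _ ≤ μ A := hE A hA

end SelectionStage

end Stage

end Selection

/-! ### The selection step and its limit -/

section Selection

variable {X : Type*} [MeasurableSpace X] {μ : Measure X} {ℬ : Set (Set X)}
  {hull : Set X → Set X} {K : ℝ≥0} {E : Set X → Set X} {a : Set X → ℝ≥0∞}
  {t : Set X → X → ℝ≥0∞} {A : Set X}

namespace SelectionStage

variable {j : ℕ} {S : Set (Set X)}

/-- The ball by which a badly covered point `x` is to be covered in the next stage. -/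
lemma exists_child (h : IsBallBasis μ ℬ hull K) (hK : 1 ≤ K)
    (hE : ∀ P ∈ ℬ, 4 * K ^ 3 * μ (E P) ≤ μ P)
    (st : SelectionStage μ ℬ hull E a t A j S) {x : X} (hx : x ∈ hull A)
    (hbad : ∀ P ∈ S, x ∈ hull P → μ A < 2 ^ (j + 1) * denseSup μ ℬ (E P) x) :
    ∃ P ∈ S, ∃ R ∈ ℬ, x ∈ hull P ∧ x ∈ R ∧ denseSup μ ℬ (E P) x ≤ 2 * μ R ∧
      (∀ P' ∈ S, x ∈ hull P' → μ R ≤ denseSup μ ℬ (E P') x) ∧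
      2 ^ j * μ R ≤ μ A ∧ μ A ≤ 2 ^ (j + 2) * μ R ∧ 2 * K ^ 3 * μ R ≤ μ P := by
  obtain ⟨P₀, hP₀, hxP₀, hcov⟩ := st.cover x hx
  obtain ⟨P, ⟨hP, hxP⟩, hmin⟩ := Set.Finite.exists_minimalFor
    (fun P => denseSup μ ℬ (E P) x) {P ∈ S | x ∈ hull P}
    ((st.finite h hK hE).subset (sep_subset _ _)) ⟨P₀, hP₀, hxP₀⟩
  have hmin' : ∀ P' ∈ S, x ∈ hull P' → denseSup μ ℬ (E P) x ≤ denseSup μ ℬ (E P') x := by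
    intro P' hP' hxP'
    rcases le_total (denseSup μ ℬ (E P) x) (denseSup μ ℬ (E P') x) with hle | hle
    · exact hle
    · exact hmin ⟨hP', hxP'⟩ hle
  have hPb := st.subset hP
  have hlt := hbad P hP hxP
  have h0 : denseSup μ ℬ (E P) x ≠ 0 := by
    intro h0
    rw [h0, mul_zero] at hlt
    exact not_lt_zero hlt
  have hle : denseSup μ ℬ (E P) x ≤ 2 * μ (E P) := denseSup_le _ _
  have hEtop : μ (E P) ≠ ∞ := by
    intro htop
    have := hE P hPb
    rw [htop, ENNReal.mul_top (by have : 0 < K := by positivity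
                                  positivity)] at this
    exact h.measure_ne_top hPb (top_le_iff.1 this)
  -- Beyond half the supremum: every dense ball through x then has at most twice the measure of R,
  -- and so lies in hull R.
  obtain ⟨R, hR, hxR, hRlt⟩ := exists_of_lt_denseSup (ENNReal.half_lt_self h0
    (ne_top_of_le_ne_top (by finiteness) hle))
  have hdR : denseSup μ ℬ (E P) x ≤ 2 * μ R := by
    rw [mul_comm]
    exact (ENNReal.div_le_iff_le_mul (by simp) (by simp)).1 hRlt.le
  have hRd := le_denseSup hR hxR
  refine ⟨P, hP, R, hR.1, hxP, hxR, hdR, fun P' hP' hxP' => hRd.trans (hmin' P' hP' hxP'), ?_, ?_, ?_⟩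
  · refine le_trans ?_ hcov
    gcongr
    exact hRd.trans (hmin' P₀ hP₀ hxP₀)
  · refine hlt.le.trans ?_
    calc 2 ^ (j + 1) * denseSup μ ℬ (E P) x ≤ 2 ^ (j + 1) * (2 * μ R) := by gcongr
      _ = 2 ^ (j + 2) * μ R := by ring
  · refine le_trans ?_ (hE P hPb)
    calc 2 * (K : ℝ≥0∞) ^ 3 * μ R ≤ 2 * K ^ 3 * (2 * μ (E P)) := by
          gcongr; exact hRd.trans hle
      _ = _ := by ring

/-- Z collects the points not yet covered at the next scale. A Vitali subfamily of their children is
disjoint, and its hulls still cover Z. -/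
lemma exists_next (h : IsBallBasis μ ℬ hull K) (hK : 1 ≤ K)
    (hE : ∀ P ∈ ℬ, 4 * K ^ 3 * μ (E P) ≤ μ P) (ha : ∀ P ∈ ℬ, a P ≠ ∞)
    (ht : ∀ P ∈ ℬ, ∀ R ∈ ℬ, hull (hull (hull R)) ⊆ hull (hull (hull P)) →
      (∀ B ∈ ℬ, hull (hull R) ⊂ B → 2 * μ (B ∩ E P) ≤ μ B) →
      ∀ z ∈ hull (hull R), t P z ≤ a P + t R z)
    (st : SelectionStage μ ℬ hull E a t A j S) :
    ∃ S', S ⊆ S' ∧ SelectionStage μ ℬ hull E a t A (j + 1) S' := by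
  classical
  have hK' : (1 : ℝ≥0∞) ≤ K := by exact_mod_cast hK
  have hA := st.subset st.root
  set Z : Set X := {x ∈ hull A | ∀ P ∈ S, x ∈ hull P → μ A < 2 ^ (j + 1) * denseSup μ ℬ (E P) x}
    with hZ
  choose! Pf hPf Rf hRf hxP hxR hdR hmin hRA hAR hRP using
    fun (x : X) (hx : x ∈ Z) => st.exists_child h hK hE hx.1 hx.2
  have hRsmall : ∀ x ∈ Z, ∀ P ∈ S, μ (Rf x) ≤ 2 * μ P := by
    intro x hx P hP
    have h1 := (hRA x hx).trans (st.size P hP)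
    rw [pow_succ, mul_assoc] at h1
    exact (ENNReal.mul_le_mul_iff_right (by positivity) (by finiteness)).1 h1
  obtain ⟨u, huZ, hdisj, hcov⟩ := Vitali.exists_disjoint_subfamily_covering_enlargement
    Rf Z (fun x => (μ (Rf x)).toReal) 2 one_lt_two (fun _ _ => ENNReal.toReal_nonneg)
    (2 * μ A).toReal
    (fun x hx => ENNReal.toReal_mono (ENNReal.mul_ne_top (by simp) (h.measure_ne_top hA))
      (hRsmall x hx A st.root))
    (fun x hx => ⟨x, hxR x hx⟩)
  have hER : ∀ R ∈ ℬ, 4 * μ (E R) ≤ μ R := fun R hR => by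
    refine le_trans ?_ (hE R hR)
    rw [mul_assoc]
    gcongr
    exact le_mul_of_one_le_left zero_le (one_le_pow₀ hK')
  -- If R were already selected, minimality would give μ R ≤ 2μ(E R) ≤ μ R / 2.
  have hnot : ∀ x ∈ Z, Rf x ∉ S := by
    intro x hx hmem
    have h1 := hmin x hx (Rf x) hmem (h.self_subset_hull (hRf x hx) (hxR x hx))
    have h2 : 2 * μ (Rf x) ≤ μ (Rf x) :=
      calc 2 * μ (Rf x) ≤ 2 * (2 * μ (E (Rf x))) := by gcongr; exact h1.trans (denseSup_le _ _)
        _ = 4 * μ (E (Rf x)) := by ring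
        _ ≤ _ := hER _ (hRf x hx)
    rw [two_mul] at h2
    have h3 := ENNReal.lt_add_right (h.measure_ne_top (hRf x hx)) (h.measure_ne_zero (hRf x hx))
    exact absurd h2 (not_le.2 h3)
  -- If R met the core of P, then R ⊆ hull P, so x ∈ hull P and minimality yields a ball D through
  -- x, dense for E P, with μ R ≤ 2μ D. Then R ⊆ hull D, which was removed from the core.
  have hcore : ∀ x ∈ Z, ∀ P ∈ S, Disjoint (P \ denseHull μ ℬ hull (E P)) (Rf x) := by
    intro x hx P hP
    by_contra hnd
    obtain ⟨z, hz, hzR⟩ := not_disjoint_iff.1 hnd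
    have hsub := h.subset_hull_of_inter (hRf x hx) (st.subset hP) (hRsmall x hx P hP) ⟨z, hzR, hz.1⟩
    have hd := hmin x hx P hP (hsub (hxR x hx))
    obtain ⟨D, hD, hxD, hlt⟩ := exists_of_lt_denseSup ((ENNReal.half_lt_self
      (h.measure_ne_zero (hRf x hx)) (h.measure_ne_top (hRf x hx))).trans_le hd)
    have hle : μ (Rf x) ≤ 2 * μ D := by
      rw [mul_comm]
      exact (ENNReal.div_le_iff_le_mul (by simp) (by simp)).1 hlt.le
    exact hz.2 (hull_subset_denseHull hD
      (h.subset_hull_of_inter (hRf x hx) hD.1 hle ⟨x, hxR x hx, hxD⟩ hzR))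
  -- The factor K³ in the smallness of E P serves here: even the third hull of R is small compared
  -- with P.
  have hnest : ∀ x ∈ Z, ∀ D ∈ ℬ, D = hull (hull (Rf x)) ∨ D = hull (hull (hull (Rf x))) →
      D ⊆ hull (hull (Pf x)) := by
    intro x hx D hD hDeq
    have hR := hRf x hx
    have hPb := st.subset (hPf x hx)
    refine h.subset_hull_of_inter hD (h.hull_mem _ hPb) ?_ ⟨x, ?_, hxP x hx⟩
    · calc μ D ≤ K ^ 3 * μ (Rf x) := by
            rcases hDeq with rfl | rfl
            · exact (measure_mono (h.hull2_subset_hull3 hR)).trans (h.measure_hull3_le hR)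
            · exact h.measure_hull3_le hR
        _ ≤ 2 * K ^ 3 * μ (Rf x) := by
            rw [mul_assoc, two_mul]; exact le_self_add
        _ ≤ μ (Pf x) := hRP x hx
        _ ≤ μ (hull (Pf x)) := measure_mono (h.self_subset_hull hPb)
        _ ≤ 2 * μ (hull (Pf x)) := by rw [two_mul]; exact le_self_add
    · rcases hDeq with rfl | rfl
      · exact h.subset_hull2 hR (hxR x hx)
      · exact h.hull2_subset_hull3 hR (h.subset_hull2 hR (hxR x hx))
  have hSS : S ⊆ S ∪ Rf '' u := subset_union_left
  refine ⟨S ∪ Rf '' u, hSS, ?_⟩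
  refine ⟨?_, Or.inl st.root, ?_, ?_, ?_, ?_, ?_⟩
  · rintro P (hP | ⟨x, hx, rfl⟩)
    exacts [st.subset hP, hRf x (huZ hx)]
  · rintro P (hP | ⟨x, hx, rfl⟩)
    · exact st.inside P hP
    · have hx := huZ hx
      exact ((hnest x hx _ (h.hull3_mem (hRf x hx)) (Or.inr rfl)).trans
        (h.hull2_subset_hull3 (st.subset (hPf x hx)))).trans (st.inside _ (hPf x hx))
  · rintro P (hP | ⟨x, hx, rfl⟩) P' (hP' | ⟨x', hx', rfl⟩) hne
    · exact st.disj hP hP' hne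
    · exact (hcore x' (huZ hx') P hP).mono_right sdiff_subset
    · exact ((hcore x (huZ hx) P' hP').mono_right sdiff_subset).symm
    · exact (hdisj hx hx' fun e => hne (by rw [e])).mono sdiff_subset sdiff_subset
  · rintro P (hP | ⟨x, hx, rfl⟩)
    · refine (st.size P hP).trans ?_
      gcongr
      · norm_num
      · omega
    · exact hAR x (huZ hx)
  · rintro P (hP | ⟨x, hx, rfl⟩) z hz
    · exact (st.dom P hP z hz).trans (by gcongr; exact hullSum_mono a hSS z)
    · have hxZ := huZ hx
      have hR := hRf x hxZ
      have hPb := st.subset (hPf x hxZ)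
      have hzP := hnest x hxZ _ (h.hull_mem _ (h.hull_mem _ hR)) (Or.inl rfl) hz
      have h1 := st.dom _ (hPf x hxZ) z hzP
      have h2 := ht _ hPb _ hR
        ((hnest x hxZ _ (h.hull3_mem hR) (Or.inr rfl)).trans (h.hull2_subset_hull3 hPb)) (by
          -- A dense B strictly containing hull (hull R) would pass through x, hence lie in hull R.
          intro B hB hBR
          by_contra hcon
          have hBd : B ∈ denseBalls μ ℬ (E (Pf x)) := ⟨hB, not_le.1 hcon⟩
          have hxB : x ∈ B := hBR.1 (h.subset_hull2 hR (hxR x hxZ))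
          exact hBR.2 ((h.subset_hull_of_inter hB hR ((le_denseSup hBd hxB).trans (hdR x hxZ))
            ⟨x, hxB, hxR x hxZ⟩).trans (h.self_subset_hull (h.hull_mem _ hR)))) z hz
      -- The invariant of the parent carries a surplus a P, exactly the cost of passing from t P to
      -- t R.
      have h3 : t A z ≤ hullSum hull a S z + t (Rf x) z := by
        refine (ENNReal.add_le_add_iff_right (ha _ hPb)).1 (h1.trans ?_)
        calc hullSum hull a S z + t (Pf x) z
            ≤ hullSum hull a S z + (a (Pf x) + t (Rf x) z) := by gcongr
          _ = _ := by ring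
      calc t A z + a (Rf x) ≤ hullSum hull a S z + t (Rf x) z + a (Rf x) := by gcongr
        _ = (hullSum hull a S z + a (Rf x)) + t (Rf x) z := by ring
        _ ≤ _ := by
            gcongr
            exact hullSum_add_le a hSS (hnot x hxZ) (Or.inr ⟨x, hx, rfl⟩)
              (h.hull2_subset_hull3 hR hz)
  · intro x hx
    by_cases hxZ : x ∈ Z
    · obtain ⟨y, hy, hne, hm⟩ := hcov x hxZ
      have hyZ := huZ hy
      refine ⟨Rf y, Or.inr ⟨y, hy, rfl⟩,
        h.subset_hull_of_inter (hRf x hxZ) (hRf y hyZ) ?_ hne (hxR x hxZ), ?_⟩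
      · rw [← ENNReal.toReal_le_toReal (h.measure_ne_top (hRf x hxZ))
          (ENNReal.mul_ne_top (by simp) (h.measure_ne_top (hRf y hyZ)))]
        simpa using hm
      -- The gained factor 2 comes from dense balls of E R having measure at most 2μ(E R) ≤ μ R / 2.
      · calc 2 ^ (j + 1) * denseSup μ ℬ (E (Rf y)) x ≤ 2 ^ (j + 1) * (2 * μ (E (Rf y))) := by
              gcongr; exact denseSup_le _ _
          _ = 2 ^ j * (4 * μ (E (Rf y))) := by ring
          _ ≤ 2 ^ j * μ (Rf y) := by gcongr; exact hER _ (hRf y hyZ)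
          _ ≤ μ A := hRA y hyZ
    · have : ∃ P ∈ S, x ∈ hull P ∧ 2 ^ (j + 1) * denseSup μ ℬ (E P) x ≤ μ A := by
        by_contra hcon
        push Not at hcon
        exact hxZ ⟨hx, hcon⟩
      obtain ⟨P, hP, hxP, hle⟩ := this
      exact ⟨P, Or.inl hP, hxP, hle⟩

end SelectionStage

/-- Sparse selection: functions `t P` which are at most `a P` off an exceptional set `E P`, and
exceed `t R` by at most `a P` on those `R` around which `E P` is not dense, are dominated by a
sparse sum. -/
theorem IsBallBasis.exists_sparse_selection (h : IsBallBasis μ ℬ hull K) (hK : 1 ≤ K)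
    (hE : ∀ P ∈ ℬ, 4 * K ^ 3 * μ (E P) ≤ μ P) (hEm : ∀ P ∈ ℬ, MeasurableSet (E P))
    (ha : ∀ P ∈ ℬ, a P ≠ ∞)
    (ht : ∀ P ∈ ℬ, ∀ R ∈ ℬ, hull (hull (hull R)) ⊆ hull (hull (hull P)) →
      (∀ B ∈ ℬ, hull (hull R) ⊂ B → 2 * μ (B ∩ E P) ≤ μ B) →
      ∀ z ∈ hull (hull R), t P z ≤ a P + t R z)
    (hoff : ∀ P ∈ ℬ, ∀ z ∉ E P, t P z ≤ a P) (hA : A ∈ ℬ) :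
    ∃ S ⊆ ℬ, A ∈ S ∧ S.PairwiseDisjoint (fun P => P \ denseHull μ ℬ hull (E P)) ∧
      ∀ᵐ x ∂μ, x ∈ hull A → t A x ≤ hullSum hull a S x := by
  classical
  choose! next hnext hstage using fun (j : ℕ) (S : Set (Set X))
    (st : SelectionStage μ ℬ hull E a t A j S) => st.exists_next h hK hE ha ht
  let S : ℕ → Set (Set X) := fun n => Nat.rec {A} next n
  have hS : ∀ n, SelectionStage μ ℬ hull E a t A n (S n) := by
    intro n
    induction n with
    | zero => exact SelectionStage.init h hK hE hA
    | succ n ih => exact hstage n _ ih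
  have hmono : Monotone S := monotone_nat_of_le_succ fun n => hnext n _ (hS n)
  have hcount : (⋃ n, S n).Countable :=
    countable_iUnion fun n => ((hS n).finite h hK hE).countable
  have hsub : (⋃ n, S n) ⊆ ℬ := iUnion_subset fun n => (hS n).subset
  have hdisj : (⋃ n, S n).PairwiseDisjoint (fun P => P \ denseHull μ ℬ hull (E P)) :=
    (pairwiseDisjoint_iUnion hmono.directed_le).2 fun n => (hS n).disj
  refine ⟨⋃ n, S n, hsub, mem_iUnion.2 ⟨0, (hS 0).root⟩, hdisj, ?_⟩
  have := hcount.to_subtype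
  -- Summability gives, by Borel–Cantelli, that almost every x lies in only finitely many of the
  -- hulls.
  have hsum : ∑' P : ⋃ n, S n, μ (hull (P : Set X)) ≠ ∞ := by
    have h1 : ∑' P : ⋃ n, S n, μ (hull (P : Set X)) ≤ K * (2 * μ (hull (hull (hull A)))) := by
      calc ∑' P : ⋃ n, S n, μ (hull (P : Set X))
          ≤ ∑' P : ⋃ n, S n, K * μ (P : Set X) :=
            ENNReal.tsum_le_tsum fun P => h.measure_hull_le _ (hsub P.2)
        _ = K * ∑' P : ⋃ n, S n, μ (P : Set X) := ENNReal.tsum_mul_left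
        _ ≤ _ := by
            gcongr
            refine h.tsum_measure_le hK hE hsub hdisj fun P hP => ?_
            obtain ⟨n, hn⟩ := mem_iUnion.1 hP
            exact (hS n).subset_top h hn
    have := h.measure_ne_top (h.hull3_mem hA)
    exact ne_top_of_le_ne_top (by finiteness) h1
  have hdense : ∀ᵐ x ∂μ, ∀ P ∈ ⋃ n, S n, x ∈ E P → ∃ B ∈ ℬ, x ∈ B ∧ μ B < 2 * μ (B ∩ E P) :=
    (ae_ball_iff hcount).2 fun P hP => h.ae_exists_dense_ball (hEm P (hsub hP))
  filter_upwards [ae_finite_setOfPred_mem hsum, hdense] with x hfin hx hxA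
  -- The least dense supremum over these finitely many hulls is at most μ A / 2^n for every n, hence
  -- zero.
  have hzero : ∃ P ∈ ⋃ n, S n, x ∈ hull P ∧ denseSup μ ℬ (E P) x = 0 := by
    by_contra hcon
    push Not at hcon
    choose P hP hxP hle using fun n => (hS n).cover x hxA
    obtain ⟨P₀, hP₀, hmin⟩ := Set.Finite.exists_minimalFor
      (fun Q : ⋃ n, S n => denseSup μ ℬ (E Q) x) _ hfin
      ⟨⟨P 0, mem_iUnion.2 ⟨0, hP 0⟩⟩, hxP 0⟩
    have h0 := hcon P₀ P₀.2 hP₀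
    have hbound : ∀ n : ℕ, 2 ^ n * denseSup μ ℬ (E P₀) x ≤ μ A := by
      intro n
      refine le_trans ?_ (hle n)
      gcongr
      rcases le_total (denseSup μ ℬ (E P₀) x) (denseSup μ ℬ (E (P n)) x) with h' | h'
      · exact h'
      · exact hmin (j := ⟨P n, mem_iUnion.2 ⟨n, hP n⟩⟩) (hxP n) h'
    have hlim : Filter.Tendsto (fun n : ℕ => (2 : ℝ≥0∞) ^ n) Filter.atTop (nhds ∞) :=
      ENNReal.tendsto_pow_atTop_nhds_top_iff.2 (by norm_num)
    have h2 : Filter.Tendsto (fun n : ℕ => (2 : ℝ≥0∞) ^ n * denseSup μ ℬ (E P₀) x) Filter.atTop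
        (nhds (∞ * denseSup μ ℬ (E P₀) x)) :=
      ENNReal.Tendsto.mul_const hlim (Or.inl (by simp))
    rw [ENNReal.top_mul h0] at h2
    exact h.measure_ne_top hA (top_le_iff.1 (le_of_tendsto' h2 hbound))
  obtain ⟨P, hP, hxP, h0⟩ := hzero
  have hPb := hsub hP
  have hxE : x ∉ E P := by
    intro hxE
    obtain ⟨B, hB, hxB, hlt⟩ := hx P hP hxE
    have := le_denseSup (μ := μ) (ℬ := ℬ) ⟨hB, hlt⟩ hxB
    rw [h0] at this
    exact h.measure_ne_zero hB (le_zero_iff.1 this)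
  obtain ⟨n, hn⟩ := mem_iUnion.1 hP
  have h1 := (hS n).dom P hn x (h.self_subset_hull (h.hull_mem _ hPb) hxP)
  refine (ENNReal.add_le_add_iff_right (ha P hPb)).1 (h1.trans ?_)
  exact add_le_add (hullSum_mono a (subset_iUnion S n) x) (hoff P hPb x hxE)

end Selection

/-! ### From selected balls to sparse operators -/

section Sparse

variable {X 𝕜 : Type*} [MeasurableSpace X] [RCLike 𝕜] {μ : Measure X} {ℬ : Set (Set X)}
  {hull : Set X → Set X} {K : ℝ≥0} {E : Set X → Set X} {S : Set (Set X)}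

namespace IsBallBasis

lemma subset_hull3 (h : IsBallBasis μ ℬ hull K) {P : Set X} (hP : P ∈ ℬ) :
    P ⊆ hull (hull (hull P)) :=
  (h.subset_hull2 hP).trans (h.hull2_subset_hull3 hP)

lemma isSparse_image_hull3 (h : IsBallBasis μ ℬ hull K) (hK : 1 ≤ K)
    (hE : ∀ P ∈ ℬ, 4 * K ^ 3 * μ (E P) ≤ μ P) (hS : S ⊆ ℬ)
    (hdisj : S.PairwiseDisjoint fun P => P \ denseHull μ ℬ hull (E P)) :
    IsSparse μ (2 * K ^ 3)⁻¹ ((fun P => hull (hull (hull P))) '' S) := by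
  choose! Pf hPf hPeq using fun (D : Set X) (hD : D ∈ (fun P => hull (hull (hull P))) '' S) => hD
  have hK0 : K ≠ 0 := by positivity
  refine ⟨fun D => Pf D \ denseHull μ ℬ hull (E (Pf D)), fun D hD => ⟨?_, ?_, ?_⟩, ?_⟩
  · exact h.measurableSet_core (hS (hPf D hD))
  · refine sdiff_subset.trans ((h.subset_hull3 (hS (hPf D hD))).trans ?_)
    exact (hPeq D hD).subset
  · have hP := hS (hPf D hD)
    rw [ENNReal.coe_inv (by positivity), ENNReal.inv_mul_le_iff (by
      simpa using hK0) (by finiteness)]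
    push_cast
    calc μ D = μ (hull (hull (hull (Pf D)))) := congrArg μ (hPeq D hD).symm
      _ ≤ K ^ 3 * μ (Pf D) := h.measure_hull3_le hP
      _ ≤ K ^ 3 * (2 * μ (Pf D \ denseHull μ ℬ hull (E (Pf D)))) := by
          gcongr; exact h.measure_le_two_mul_core hK hE hP
      _ = _ := by ring
  · intro D hD D' hD' hne
    refine hdisj (hPf D hD) (hPf D' hD') fun e => hne ?_
    rw [← hPeq D hD, ← hPeq D' hD', e]

lemma hullSum_le_sparseOp (h : IsBallBasis μ ℬ hull K) (hK : 1 ≤ K)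
    (hE : ∀ P ∈ ℬ, 4 * K ^ 3 * μ (E P) ≤ μ P) (hS : S ⊆ ℬ)
    (hdisj : S.PairwiseDisjoint fun P => P \ denseHull μ ℬ hull (E P))
    (c : ℝ≥0∞) (r : ℝ) (f : X → 𝕜) (x : X) :
    hullSum hull (fun P => c * ballAvg μ r f (hull (hull (hull P)))) S x ≤
      2 * K ^ 3 * c * sparseOp μ ((fun P => hull (hull (hull P))) '' S) r f x := by
  set H : Set X → Set X := fun P => hull (hull (hull P)) with hH
  set v : Set X → ℝ≥0∞ := fun D => D.indicator (fun _ => ballAvg μ r f D) x with hv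
  let φ : S → H '' S := fun P => ⟨H P, P, P.2, rfl⟩
  have h1 : hullSum hull (fun P => c * ballAvg μ r f (hull (hull (hull P)))) S x =
      ∑' P : S, c * v (φ P) := by
    rw [hullSum, ← tsum_subtype]
    refine tsum_congr fun P => ?_
    by_cases hx : x ∈ H P
    · simp only [hv, φ, indicator_of_mem hx]
      exact indicator_of_mem hx _
    · simp only [hv, φ, indicator_of_notMem hx, mul_zero]
      exact indicator_of_notMem hx _
  have hfib : ∀ D : H '' S, ∑' P : {P : S // φ P = D}, c * v (φ P) ≤ 2 * K ^ 3 * c * v D := by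
    intro D
    obtain ⟨P₀, hP₀, hD⟩ := D.2
    have hDb : (D : Set X) ∈ ℬ := hD ▸ h.hull3_mem (hS hP₀)
    -- Different P may share a third hull D. Their disjoint cores lie in D and each has measure at
    -- least μ D / (2K³), which bounds the multiplicity.
    have hcard : (∑' _ : {P : S // φ P = D}, (1 : ℝ≥0∞)) ≤ 2 * K ^ 3 := by
      refine (ENNReal.mul_le_mul_iff_left (h.measure_ne_zero hDb) (h.measure_ne_top hDb)).1 ?_
      rw [← ENNReal.tsum_mul_right]
      set S' : Set (Set X) := {P ∈ S | H P = D} with hS'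
      have hle := h.tsum_measure_le hK hE (S := S') (D := D) (fun P hP => hS hP.1)
        (hdisj.subset fun P hP => hP.1)
        (fun P hP => (h.subset_hull3 (hS hP.1)).trans hP.2.subset)
      let ψ : {P : S // φ P = D} → S' := fun P => ⟨P.1, P.1.2, congrArg Subtype.val P.2⟩
      have hψ : Function.Injective ψ := fun P P' hPP =>
        Subtype.ext (Subtype.ext (congrArg (fun Q : S' => (Q : Set X)) hPP))
      calc ∑' P : {P : S // φ P = D}, 1 * μ (D : Set X)
          ≤ ∑' P : {P : S // φ P = D}, K ^ 3 * μ (ψ P : Set X) := by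
            refine ENNReal.tsum_le_tsum fun P => ?_
            rw [one_mul, ← (ψ P).2.2]
            exact h.measure_hull3_le (hS (ψ P).2.1)
        _ = K ^ 3 * ∑' P : {P : S // φ P = D}, μ (ψ P : Set X) := ENNReal.tsum_mul_left
        _ ≤ K ^ 3 * ∑' P : S', μ (P : Set X) := by
            gcongr
            exact ENNReal.tsum_comp_le_tsum_of_injective hψ fun P : S' => μ (P : Set X)
        _ ≤ K ^ 3 * (2 * μ (D : Set X)) := by gcongr
        _ = _ := by ring
    calc ∑' P : {P : S // φ P = D}, c * v (φ P)
        = ∑' P : {P : S // φ P = D}, 1 * (c * v D) := by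
          refine tsum_congr fun P => ?_
          rw [P.2, one_mul]
      _ = (∑' _ : {P : S // φ P = D}, (1 : ℝ≥0∞)) * (c * v D) := ENNReal.tsum_mul_right
      _ ≤ 2 * K ^ 3 * (c * v D) := by gcongr
      _ = _ := by ring
  calc hullSum hull (fun P => c * ballAvg μ r f (hull (hull (hull P)))) S x
      = ∑' P : S, c * v (φ P) := h1
    _ = ∑' q : Σ D : H '' S, {P : S // φ P = D}, c * v (φ q.2) :=
        ((Equiv.sigmaFiberEquiv φ).tsum_eq fun P => c * v (φ P)).symm
    _ = ∑' D : H '' S, ∑' P : {P : S // φ P = D}, c * v (φ P) := ENNReal.tsum_sigma' _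
    _ ≤ ∑' D : H '' S, 2 * K ^ 3 * c * v D := ENNReal.tsum_le_tsum hfib
    _ = 2 * K ^ 3 * c * ∑' D : H '' S, v D := ENNReal.tsum_mul_left
    _ = _ := rfl

end IsBallBasis

end Sparse

/-! ### The distance on extended nonnegative reals -/

section ENNRealDistance

lemma ENNReal.edist_coe_coe (a b : ℝ≥0) :
    edist (a : ℝ≥0∞) (b : ℝ≥0∞) = max ((a : ℝ≥0∞) - b) (b - a) := by
  change edist a b = _
  rw [edist_nndist, NNReal.nndist_eq]
  push_cast
  rfl

lemma ENNReal.edist_top_coe (b : ℝ≥0) : edist (∞ : ℝ≥0∞) (b : ℝ≥0∞) = ∞ :=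
  (ENNReal.edist_eq_top_iff _ _).2 ⟨by simp, Or.inl rfl⟩

lemma ENNReal.le_add_edist (a b : ℝ≥0∞) : a ≤ b + edist a b := by
  induction a with
  | top =>
    induction b with
    | top => simp
    | coe b => simp [ENNReal.edist_top_coe]
  | coe a =>
    induction b with
    | top => simp
    | coe b =>
      rw [ENNReal.edist_coe_coe]
      exact le_add_tsub.trans (by gcongr; exact le_max_left _ _)

lemma ENNReal.edist_le_of_le_add {a b c : ℝ≥0∞} (hab : a ≤ b + c) (hba : b ≤ a + c) :
    edist a b ≤ c := by
  induction a with
  | top =>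
    induction b with
    | top => exact (show edist (∞ : ℝ≥0∞) ∞ = 0 from rfl).le.trans zero_le
    | coe b =>
      have : c = ∞ := by simpa using hab
      simp [this]
  | coe a =>
    induction b with
    | top =>
      have : c = ∞ := by simpa using hba
      simp [this]
    | coe b =>
      rw [ENNReal.edist_coe_coe]
      exact max_le (tsub_le_iff_left.2 hab) (tsub_le_iff_left.2 hba)

lemma ENNReal.edist_enorm_le {𝕜 : Type*} [RCLike 𝕜] (a b : 𝕜) : edist ‖a‖ₑ ‖b‖ₑ ≤ edist a b := by
  rw [edist_eq_enorm_sub]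
  refine ENNReal.edist_le_of_le_add ?_ ?_
  · calc ‖a‖ₑ = ‖b + (a - b)‖ₑ := by congr 1; ring
      _ ≤ _ := enorm_add_le _ _
  · rw [← enorm_neg (a - b), neg_sub]
    calc ‖b‖ₑ = ‖a + (b - a)‖ₑ := by congr 1; ring
      _ ≤ _ := enorm_add_le _ _

end ENNRealDistance

/-! ### Averages over balls -/

section Averages

variable {X 𝕜 : Type*} [MeasurableSpace X] [RCLike 𝕜] {μ : Measure X} {r : ℝ} {f g : X → 𝕜}

lemma ballAvg_le_iff (hr : 1 ≤ r) {B : Set X} (h0 : μ B ≠ 0) (htop : μ B ≠ ∞) {M : ℝ≥0∞} :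
    ballAvg μ r f B ≤ M ↔ ∫⁻ x in B, ‖f x‖ₑ ^ r ∂μ ≤ M ^ r * μ B := by
  rw [ballAvg, one_div, ENNReal.rpow_inv_le_iff (by positivity),
    ENNReal.inv_mul_le_iff h0 htop, mul_comm]

lemma ballAvg_rpow_mul (hr : 1 ≤ r) {B : Set X} (h0 : μ B ≠ 0) (htop : μ B ≠ ∞) :
    ballAvg μ r f B ^ r * μ B = ∫⁻ x in B, ‖f x‖ₑ ^ r ∂μ := by
  rw [ballAvg, one_div, ENNReal.rpow_inv_rpow (by positivity), mul_comm, ← mul_assoc,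
    ENNReal.mul_inv_cancel h0 htop, one_mul]

lemma ballAvg_mono {B : Set X} (hr : 1 ≤ r) (hfg : ∀ x, ‖f x‖ₑ ≤ ‖g x‖ₑ) :
    ballAvg μ r f B ≤ ballAvg μ r g B := by
  unfold ballAvg
  gcongr
  exact hfg _

omit [MeasurableSpace X] in
lemma enorm_indicator_le (s : Set X) (f : X → 𝕜) (x : X) : ‖s.indicator f x‖ₑ ≤ ‖f x‖ₑ := by
  by_cases hx : x ∈ s <;> simp [hx]

lemma eLpNorm_rpow (hr : 1 ≤ r) :
    eLpNorm f (ENNReal.ofReal r) μ ^ r = ∫⁻ x, ‖f x‖ₑ ^ r ∂μ := by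
  have hr0 : 0 < r := by positivity
  rw [eLpNorm_eq_lintegral_rpow_enorm_toReal (by simpa using hr0) ENNReal.ofReal_ne_top,
    ENNReal.toReal_ofReal hr0.le, one_div, ENNReal.rpow_inv_rpow hr0.ne']

lemma MeasureTheory.MemLp.lintegral_ne_top (hr : 1 ≤ r) (hf : MemLp f (ENNReal.ofReal r) μ) :
    ∫⁻ x, ‖f x‖ₑ ^ r ∂μ ≠ ∞ := by
  rw [← eLpNorm_rpow hr]
  exact ENNReal.rpow_ne_top_of_nonneg (by positivity) hf.2.ne

lemma ae_eq_zero_of_lintegral_eq_zero (hr : 1 ≤ r) (hf : MemLp f (ENNReal.ofReal r) μ)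
    (h0 : ∫⁻ x, ‖f x‖ₑ ^ r ∂μ = 0) : f =ᵐ[μ] 0 := by
  have hr0 : 0 < r := by positivity
  rw [← eLpNorm_rpow hr, ENNReal.rpow_eq_zero_iff_of_pos hr0] at h0
  exact (eLpNorm_eq_zero_iff hf.1 (by simpa using hr0)).1 h0

lemma lintegral_indicator_rpow (hr : 1 ≤ r) {s : Set X} (hs : MeasurableSet s) :
    ∫⁻ x, ‖s.indicator f x‖ₑ ^ r ∂μ = ∫⁻ x in s, ‖f x‖ₑ ^ r ∂μ := by
  rw [← lintegral_indicator hs]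
  congr 1 with x
  by_cases hx : x ∈ s
  · simp [hx]
  · simp [hx, ENNReal.zero_rpow_of_pos (show 0 < r by positivity)]

lemma ballAvg_ne_top (hr : 1 ≤ r) (hf : MemLp f (ENNReal.ofReal r) μ) {B : Set X}
    (h0 : μ B ≠ 0) : ballAvg μ r f B ≠ ∞ := by
  refine ENNReal.rpow_ne_top_of_nonneg (by positivity) (ENNReal.mul_ne_top (by simpa using h0) ?_)
  exact ne_top_of_le_ne_top (hf.lintegral_ne_top hr) (setLIntegral_le_lintegral _ _)

lemma ballAvgStar_le {ℬ : Set (Set X)} {B : Set X} {M : ℝ≥0∞}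
    (hM : ∀ A ∈ ℬ, B ⊆ A → ballAvg μ r f A ≤ M) : ballAvgStar μ ℬ r f B ≤ M :=
  iSup₂_le fun A hA => hM A hA.1 hA.2

lemma ballAvg_le_of_lintegral_le (hr : 1 ≤ r) {A B : Set X} (h0 : μ B ≠ 0) (hBA : B ⊆ A)
    (htop : μ A ≠ ∞) {M : ℝ≥0∞} (hM : ∫⁻ x, ‖f x‖ₑ ^ r ∂μ ≤ M ^ r * μ B) :
    ballAvg μ r f A ≤ M := by
  have hAB : μ B ≤ μ A := measure_mono hBA
  rw [ballAvg_le_iff hr (fun h => h0 (le_zero_iff.1 (hAB.trans h.le))) htop]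
  exact (setLIntegral_le_lintegral _ _).trans (hM.trans (by gcongr))

/-- Averages over balls containing B are bounded by the total mass over μ B. Finiteness permits
clearing denominators in the localization constant. -/
lemma ballAvgStar_ne_top {ℬ : Set (Set X)} {hull : Set X → Set X} {K : ℝ≥0}
    (h : IsBallBasis μ ℬ hull K) (hr : 1 ≤ r) (hf : MemLp f (ENNReal.ofReal r) μ) {B : Set X}
    (hB : B ∈ ℬ) : ballAvgStar μ ℬ r f B ≠ ∞ := by
  have hr0 : 0 < r := by positivity
  have h0 := h.measure_ne_zero hB
  set M := ((∫⁻ x, ‖f x‖ₑ ^ r ∂μ) / μ B) ^ r⁻¹ with hM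
  have hMtop : M ≠ ∞ := ENNReal.rpow_ne_top_of_nonneg (by positivity)
    (ENNReal.div_ne_top (hf.lintegral_ne_top hr) h0)
  refine ne_top_of_le_ne_top hMtop (ballAvgStar_le fun A hA hBA =>
    ballAvg_le_of_lintegral_le hr h0 hBA (h.measure_ne_top hA) ?_)
  rw [hM, ENNReal.rpow_inv_rpow hr0.ne', ENNReal.div_mul_cancel h0 (h.measure_ne_top hB)]

end Averages

/-! ### Subadditive operators and their constants -/

section Operators

variable {X 𝕜 : Type*} [MeasurableSpace X] [RCLike 𝕜] {μ : Measure X} {ℬ : Set (Set X)}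
  {hull : Set X → Set X} {K : ℝ≥0} {r : ℝ} {T : (X → 𝕜) → X → ℝ≥0∞} {f : X → 𝕜}

namespace IsSubadditive

lemma eq_zero_of_ae (hT : IsSubadditive μ r T) (hf : MemLp f (ENNReal.ofReal r) μ)
    (h0 : f =ᵐ[μ] 0) (x : X) : T f x = 0 := by
  have hz : MemLp (0 : X → 𝕜) (ENNReal.ofReal r) μ := MemLp.zero
  rw [hT.congr_ae f 0 hf hz h0]
  simpa using hT.smul 0 0 hz x

lemma add_le' (hT : IsSubadditive μ r T) {f₁ f₂ : X → 𝕜} (h₁ : MemLp f₁ (ENNReal.ofReal r) μ)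
    (h₂ : MemLp f₂ (ENNReal.ofReal r) μ) (hf : f = f₁ + f₂) (x : X) :
    T f x ≤ T f₁ x + T f₂ x := by
  rw [hf]
  simpa using hT.add_le f₁ f₂ h₁ h₂ x

lemma sub_le' (hT : IsSubadditive μ r T) {f₁ f₂ : X → 𝕜} (h₁ : MemLp f₁ (ENNReal.ofReal r) μ)
    (h₂ : MemLp f₂ (ENNReal.ofReal r) μ) (hf : f = f₁ - f₂) (x : X) :
    T f x ≤ T f₁ x + T f₂ x := by
  have h := hT.smul (-1) f₂ h₂ x
  have h' : T ((-1 : ℝ) • f₂) x = T f₂ x := by simpa using h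
  rw [← h']
  exact hT.add_le' h₁ (h₂.const_smul (-1 : ℝ)) (by rw [hf, neg_one_smul, sub_eq_add_neg]) x

end IsSubadditive

lemma weak_type_le (hr : 1 ≤ r) (hT : IsSubadditive μ r T) {N : ℝ≥0∞}
    (hN : weakNorm μ r T ≤ N) (hf : MemLp f (ENNReal.ofReal r) μ) {t : ℝ≥0∞}
    (ht : 0 < t) (httop : t ≠ ∞) :
    t ^ r * μ {x | t < T f x} ≤ N ^ r * ∫⁻ x, ‖f x‖ₑ ^ r ∂μ := by
  have hr0 : 0 < r := by positivity
  lift t to ℝ≥0 using httop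
  by_cases h0 : eLpNorm f (ENNReal.ofReal r) μ = 0
  · have hz := (eLpNorm_eq_zero_iff hf.1 (by simpa using hr0)).1 h0
    simp [hT.eq_zero_of_ae hf hz]
  have h1 : ((t : ℝ≥0∞) * μ {x | (t : ℝ≥0∞) < ‖T f x‖ₑ} ^ (1 / r)) /
      eLpNorm f (ENNReal.ofReal r) μ ≤ N := by
    refine le_trans ?_ hN
    exact le_iSup₂_of_le t (by exact_mod_cast ht) (le_iSup₂_of_le f hf le_rfl)
  rw [ENNReal.div_le_iff_le_mul (Or.inl h0) (Or.inl hf.2.ne)] at h1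
  have h2 := ENNReal.rpow_le_rpow h1 hr0.le
  rw [ENNReal.mul_rpow_of_nonneg _ _ hr0.le, ENNReal.mul_rpow_of_nonneg _ _ hr0.le,
    eLpNorm_rpow hr, one_div, ENNReal.rpow_inv_rpow hr0.ne'] at h2
  simpa using h2

lemma localConst_osc (h : IsBallBasis μ ℬ hull K) (hr : 1 ≤ r) {L : ℝ≥0∞}
    (hL : localConst μ ℬ hull r T ≤ L) (hLtop : L ≠ ∞) (hf : MemLp f (ENNReal.ofReal r) μ)
    {B : Set X} (hB : B ∈ ℬ) {x x' : X} (hx : x ∈ B) (hx' : x' ∈ B) :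
    edist (T ((hull B)ᶜ.indicator f) x) (T ((hull B)ᶜ.indicator f) x') ≤
      L * ballAvgStar μ ℬ r f B := by
  rw [← ENNReal.div_le_iff_le_mul (Or.inr hLtop) (Or.inl (ballAvgStar_ne_top h hr hf hB))]
  refine le_trans ?_ hL
  exact le_iSup₂_of_le B hB (le_iSup₂_of_le x hx (le_iSup₂_of_le x' hx' (le_iSup₂_of_le f hf le_rfl)))

end Operators

/-! ### Pointwise bounds from localization, connectivity and weak type -/

section Operators

variable {X 𝕜 : Type*} [MeasurableSpace X] [RCLike 𝕜] {μ : Measure X} {ℬ : Set (Set X)}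
  {hull : Set X → Set X} {K : ℝ≥0} {r : ℝ} {T : (X → 𝕜) → X → ℝ≥0∞} {f : X → 𝕜}

lemma localConst_osc_le (h : IsBallBasis μ ℬ hull K) (hr : 1 ≤ r) {L : ℝ≥0∞}
    (hL : localConst μ ℬ hull r T ≤ L) (hLtop : L ≠ ∞) (hf : MemLp f (ENNReal.ofReal r) μ)
    {B : Set X} (hB : B ∈ ℬ) {M : ℝ≥0∞} (hM : ∀ A ∈ ℬ, B ⊆ A → ballAvg μ r f A ≤ M)
    {x x' : X} (hx : x ∈ B) (hx' : x' ∈ B) :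
    T ((hull B)ᶜ.indicator f) x ≤ T ((hull B)ᶜ.indicator f) x' + L * M := by
  refine (ENNReal.le_add_edist _ (T ((hull B)ᶜ.indicator f) x')).trans ?_
  gcongr
  refine (localConst_osc h hr hL hLtop hf hB hx hx').trans ?_
  gcongr
  exact ballAvgStar_le hM

/-- The part of `f` away from `hull D` contributes boundedly on `D`. -/
lemma far_bound (h : IsBallBasis μ ℬ hull K) (hr : 1 ≤ r) (hT : IsSubadditive μ r T)
    {L N : ℝ≥0∞} (hL : localConst μ ℬ hull r T ≤ L) (hLtop : L ≠ ∞)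
    (hN : weakNorm μ r T ≤ N) (hf : MemLp f (ENNReal.ofReal r) μ)
    {D : Set X} (hD : D ∈ ℬ) {M : ℝ≥0∞}
    (hM : ∫⁻ x, ‖f x‖ₑ ^ r ∂μ ≤ M ^ r * μ D) {x : X} (hx : x ∈ D) :
    T ((hull D)ᶜ.indicator f) x ≤ (L + N) * M := by
  have hr0 : 0 < r := by positivity
  have h0 := h.measure_ne_zero hD
  have htop := h.measure_ne_top hD
  set g := (hull D)ᶜ.indicator f with hg
  have hgm : MemLp g (ENNReal.ofReal r) μ :=
    hf.indicator (h.measurableSet _ (h.hull_mem _ hD)).compl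
  have hgM : ∫⁻ x, ‖g x‖ₑ ^ r ∂μ ≤ M ^ r * μ D :=
    (lintegral_mono fun x => by gcongr; exact enorm_indicator_le _ _ _).trans hM
  rw [add_mul]
  refine le_of_forall_gt_imp_ge_of_dense fun s hs => ?_
  have hs' : N * M < s - L * M := by
    rw [add_comm] at hs
    exact lt_tsub_iff_right.2 hs
  obtain ⟨t, ht1, ht2⟩ := exists_between hs'
  have htpos : 0 < t := pos_of_gt ht1
  have httop : t ≠ ∞ := ht2.ne_top
  have hw := weak_type_le hr hT hN hgm htpos httop
  -- Any level t > N * M leaves a point of D where T g ≤ t; oscillation transfers this to x at cost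
  -- L * M.
  have hlt : μ {x | t < T g x} < μ D := by
    have h1 : t ^ r * μ {x | t < T g x} < t ^ r * μ D := by
      refine (hw.trans (mul_le_mul_right hgM _)).trans_lt ?_
      rw [← mul_assoc, ← ENNReal.mul_rpow_of_nonneg _ _ hr0.le]
      exact ENNReal.mul_lt_mul_left h0 htop (ENNReal.rpow_lt_rpow ht1 hr0)
    exact lt_of_mul_lt_mul_left' h1
  obtain ⟨x', hx', hxt⟩ : ∃ x' ∈ D, T g x' ≤ t := by
    by_contra hcon
    push Not at hcon
    exact absurd (measure_mono (μ := μ) fun x hx => hcon x hx) (not_le.2 hlt)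
  calc T g x ≤ T g x' + L * M := localConst_osc_le h hr hL hLtop hf hD (fun A hA hDA =>
        ballAvg_le_of_lintegral_le hr h0 hDA (h.measure_ne_top hA) hM) hx hx'
    _ ≤ (s - L * M) + L * M := by gcongr; exact hxt.trans ht2.le
    _ = s := tsub_add_cancel_of_le ((le_add_right le_rfl).trans hs.le)

lemma exists_connecting_ball (h : IsBallBasis μ ℬ hull K) (hr : 1 ≤ r) {M : ℝ≥0∞}
    (hM : connectConst μ ℬ hull r T < M) (hMtop : M ≠ ∞) {A : Set X} (hA : A ∈ ℬ)
    (hne : hull A ≠ univ) :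
    ∃ B ∈ ℬ, A ⊂ B ∧ ∀ x ∈ A, ∀ f : X → 𝕜, MemLp f (ENNReal.ofReal r) μ →
      T ((hull B \ hull A).indicator f) x ≤ M * ballAvg μ r f (hull B) := by
  obtain ⟨L, hL, hLM⟩ := sInf_lt_iff.1 hM
  obtain ⟨B, hB, hAB, hle⟩ := hL A hA hne
  refine ⟨B, hB, hAB, fun x hx f hf => ?_⟩
  rw [← ENNReal.div_le_iff_le_mul (Or.inr hMtop) (Or.inl (ballAvg_ne_top hr hf
    (h.measure_ne_zero (h.hull_mem _ hB))))]
  refine le_trans ?_ (hle.trans hLM.le)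
  exact le_iSup₂_of_le x hx (le_iSup₂_of_le f hf le_rfl)

/-- The set where `T f` or the maximal function of `f` is large. -/
def exceptionalSet (μ : Measure X) (ℬ : Set (Set X)) (r : ℝ) (T : (X → 𝕜) → X → ℝ≥0∞) (L : ℝ≥0∞)
    (f : X → 𝕜) (σ : ℝ≥0∞) : Set X :=
  {x | L * σ < T f x} ∪ ⋃₀ {B ∈ ℬ | σ < ballAvg μ r f B}

/-- Both parts are weak-type bounds: the hypothesis on T at level L * σ, and the covering lemma with
density |f|^r for the maximal function. -/
lemma measure_exceptionalSet_le (h : IsBallBasis μ ℬ hull K) (hr : 1 ≤ r)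
    (hT : IsSubadditive μ r T) {L : ℝ≥0∞} (hN : weakNorm μ r T ≤ L) (hL0 : L ≠ 0)
    (hLtop : L ≠ ∞) (hf : MemLp f (ENNReal.ofReal r) μ) {σ : ℝ≥0∞} (hσ0 : σ ≠ 0) (hσ : σ ≠ ∞) :
    σ ^ r * μ (exceptionalSet μ ℬ r T L f σ) ≤ (1 + K) * ∫⁻ x, ‖f x‖ₑ ^ r ∂μ := by
  have hr0 : 0 < r := by positivity
  have hσr0 : σ ^ r ≠ 0 := by simp [hσ0, hσ]
  have hσr : σ ^ r ≠ ∞ := ENNReal.rpow_ne_top_of_nonneg hr0.le hσ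
  have hLr0 : L ^ r ≠ 0 := by simp [hL0, hLtop]
  have hLr : L ^ r ≠ ∞ := ENNReal.rpow_ne_top_of_nonneg hr0.le hLtop
  have h1 : σ ^ r * μ {x | L * σ < T f x} ≤ ∫⁻ x, ‖f x‖ₑ ^ r ∂μ := by
    have hw := weak_type_le hr hT hN hf (t := L * σ)
      (pos_iff_ne_zero.2 (mul_ne_zero hL0 hσ0)) (ENNReal.mul_ne_top hLtop hσ)
    rw [ENNReal.mul_rpow_of_nonneg _ _ hr0.le, mul_assoc] at hw
    exact (ENNReal.mul_le_mul_iff_right hLr0 hLr).1 hw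
  have h2 : σ ^ r * μ (⋃₀ {B ∈ ℬ | σ < ballAvg μ r f B}) ≤ K * ∫⁻ x, ‖f x‖ₑ ^ r ∂μ := by
    have hu : (μ.withDensity fun x => ‖f x‖ₑ ^ r) univ = ∫⁻ x, ‖f x‖ₑ ^ r ∂μ := by
      rw [withDensity_apply _ MeasurableSet.univ, Measure.restrict_univ]
    have hm := h.measure_sUnion_le (𝒞 := {B ∈ ℬ | σ < ballAvg μ r f B}) (sep_subset _ _)
      (ν := μ.withDensity fun x => ‖f x‖ₑ ^ r) (by rw [hu]; exact hf.lintegral_ne_top hr)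
      (c := (σ ^ r)⁻¹) (by simpa using hσr0) (by
        rintro B ⟨hB, hlt⟩
        rw [withDensity_apply _ (h.measurableSet B hB), ← ENNReal.div_eq_inv_mul,
          ENNReal.le_div_iff_mul_le (Or.inl hσr0) (Or.inl hσr), mul_comm]
        by_contra hcon
        exact absurd ((ballAvg_le_iff hr (h.measure_ne_zero hB) (h.measure_ne_top hB)).2
          (not_le.1 hcon).le) (not_le.2 hlt))
    rw [hu] at hm
    calc σ ^ r * μ (⋃₀ {B ∈ ℬ | σ < ballAvg μ r f B})
        ≤ σ ^ r * (K * (σ ^ r)⁻¹ * ∫⁻ x, ‖f x‖ₑ ^ r ∂μ) := by gcongr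
      _ = (σ ^ r * (σ ^ r)⁻¹) * (K * ∫⁻ x, ‖f x‖ₑ ^ r ∂μ) := by ring
      _ = _ := by rw [ENNReal.mul_inv_cancel hσr0 hσr, one_mul]
  calc σ ^ r * μ (exceptionalSet μ ℬ r T L f σ)
      ≤ σ ^ r * (μ {x | L * σ < T f x} + μ (⋃₀ {B ∈ ℬ | σ < ballAvg μ r f B})) := by
        gcongr; exact measure_union_le _ _
    _ ≤ _ := by rw [mul_add, add_mul, one_mul]; exact add_le_add h1 h2

/-- If `B` meets the complement of the exceptional set, then `f` has controlled mass on
`hull Q ∪ hull B` for every ball `Q ⊆ B`. -/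
lemma lintegral_hull_union_le (h : IsBallBasis μ ℬ hull K) (hr : 1 ≤ r) {Q B : Set X}
    (hQ : Q ∈ ℬ) (hB : B ∈ ℬ) (hQB : Q ⊆ B) {σ : ℝ≥0∞} {y : X} (hy : y ∈ B)
    (hyσ : ∀ A ∈ ℬ, y ∈ A → ballAvg μ r f A ≤ σ) :
    ∫⁻ x in hull Q ∪ hull B, ‖f x‖ₑ ^ r ∂μ ≤ σ ^ r * (K ^ 2 * μ B) := by
  have hmain : ∀ A ∈ ℬ, hull Q ∪ hull B ⊆ A → μ A ≤ K ^ 2 * μ B →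
      ∫⁻ x in hull Q ∪ hull B, ‖f x‖ₑ ^ r ∂μ ≤ σ ^ r * (K ^ 2 * μ B) := by
    intro A hA hsub hle
    refine (lintegral_mono_set hsub).trans (((ballAvg_le_iff hr (h.measure_ne_zero hA)
      (h.measure_ne_top hA)).1 (hyσ A hA (hsub (Or.inr (h.self_subset_hull hB hy))))).trans ?_)
    gcongr
  have hQ' := h.hull_mem _ hQ
  have hB' := h.hull_mem _ hB
  obtain ⟨q, hq⟩ := h.nonempty_ball hQ
  have hqQ := h.self_subset_hull hQ hq
  have hqB := h.self_subset_hull hB (hQB hq)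
  -- Hulls need not be monotone; whichever hull has larger measure swallows the other after one more
  -- hull.
  rcases le_total (μ (hull Q)) (μ (hull B)) with hle | hle
  · refine hmain _ (h.hull_mem _ hB') (union_subset ?_ (h.self_subset_hull hB'))
      (h.measure_hull2_le hB)
    exact h.subset_hull_of_inter hQ' hB' (hle.trans (by rw [two_mul]; exact le_self_add))
      ⟨q, hqQ, hqB⟩
  · refine hmain _ (h.hull_mem _ hQ') (union_subset (h.self_subset_hull hQ') ?_)
      ((h.measure_hull2_le hQ).trans (by gcongr))
    exact h.subset_hull_of_inter hB' hQ' (hle.trans (by rw [two_mul]; exact le_self_add))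
      ⟨q, hqB, hqQ⟩

/-- If the exceptional set is not dense in any ball strictly larger than `Q`, the part of `f` away
from `hull Q` contributes boundedly on `Q`. -/
lemma local_step (h : IsBallBasis μ ℬ hull K) (hK : 1 ≤ K) (hr : 1 ≤ r)
    (hT : IsSubadditive μ r T) {L : ℝ≥0∞} (hL₁ : localConst μ ℬ hull r T ≤ L)
    (hL₂ : connectConst μ ℬ hull r T ≤ L) (hN : weakNorm μ r T ≤ L) (hL0 : L ≠ 0) (hLtop : L ≠ ∞)
    (hf : MemLp f (ENNReal.ofReal r) μ) {σ : ℝ≥0∞} (hσ0 : σ ≠ 0) (hσ : σ ≠ ∞) {E Q : Set X}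
    (hE : exceptionalSet μ ℬ r T L f σ ⊆ E) (hQ : Q ∈ ℬ)
    (hdense : ∀ B ∈ ℬ, Q ⊂ B → 2 * μ (B ∩ E) ≤ μ B) {z : X} (hz : z ∈ Q) :
    T ((hull Q)ᶜ.indicator f) z ≤ 8 * K ^ 2 * (L * σ) := by
  have hr0 : 0 < r := by positivity
  have hK' : (1 : ℝ≥0∞) ≤ K := by exact_mod_cast hK
  have hK2 : (1 : ℝ≥0∞) ≤ K ^ 2 := one_le_pow₀ hK'
  have hQm := h.measurableSet _ (h.hull_mem _ hQ)
  by_cases huniv : hull Q = univ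
  · rw [hT.eq_zero_of_ae (hf.indicator hQm.compl)
      (by rw [huniv, compl_univ, indicator_empty]; rfl) z]
    exact zero_le
  -- The constant is an infimum, so a strict margin is needed; 2 * L provides it as L is neither 0
  -- nor ∞.
  obtain ⟨B, hB, hQB, hconn⟩ := exists_connecting_ball h hr (M := 2 * L)
    (hL₂.trans_lt (by rw [two_mul]; exact ENNReal.lt_add_right hLtop hL0))
    (ENNReal.mul_ne_top (by simp) hLtop) hQ huniv
  have hBm := h.measurableSet _ (h.hull_mem _ hB)
  have hB0 := h.measure_ne_zero hB
  have hBtop := h.measure_ne_top hB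
  have hBE := hdense B hB hQB
  have hout : ∀ y ∉ E, T f y ≤ L * σ ∧ ∀ A ∈ ℬ, y ∈ A → ballAvg μ r f A ≤ σ := by
    intro y hy
    have hy' : y ∉ exceptionalSet μ ℬ r T L f σ := fun h' => hy (hE h')
    rw [exceptionalSet, mem_union, not_or] at hy'
    exact ⟨not_lt.1 hy'.1, fun A hA hyA => not_lt.1 fun hlt => hy'.2 ⟨A, ⟨hA, hlt⟩, hyA⟩⟩
  obtain ⟨y, hyB, hyE⟩ : ∃ y ∈ B, y ∉ E := by
    by_contra hcon
    push Not at hcon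
    rw [inter_eq_left.2 hcon, two_mul] at hBE
    exact absurd hBE (not_le.2 (ENNReal.lt_add_right hBtop hB0))
  have hI := lintegral_hull_union_le (f := f) h hr hQ hB hQB.1 hyB (hout y hyE).2
  set f' := (hull Q ∪ hull B).indicator f with hf'
  have hf'm : MemLp f' (ENNReal.ofReal r) μ := hf.indicator (hQm.union hBm)
  have hLσ0 : L * σ ≠ 0 := mul_ne_zero hL0 hσ0
  have hLσ : L * σ ≠ ∞ := ENNReal.mul_ne_top hLtop hσ
  have hw := weak_type_le hr hT hN hf'm (t := 4 * K ^ 2 * (L * σ))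
    (pos_iff_ne_zero.2 (mul_ne_zero (by positivity) hLσ0)) (by finiteness)
  rw [lintegral_indicator_rpow hr (hQm.union hBm)] at hw
  set G := {x | 4 * K ^ 2 * (L * σ) < T f' x} with hG
  -- E fills at most half of B and G at most a quarter, so B has a point outside both. The level 4K²
  -- offsets the K² in the mass of f'.
  have hGB : 4 * μ G ≤ μ B := by
    have hc0 : (L * σ) ^ r * K ^ 2 ≠ 0 := mul_ne_zero (by simp [hLσ0, hLσ]) (by positivity)
    have hc : (L * σ) ^ r * K ^ 2 ≠ ∞ :=
      ENNReal.mul_ne_top (ENNReal.rpow_ne_top_of_nonneg hr0.le hLσ) (by finiteness)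
    refine (ENNReal.mul_le_mul_iff_right hc0 hc).1 ?_
    calc (L * σ) ^ r * K ^ 2 * (4 * μ G) = (4 * K ^ 2) * (L * σ) ^ r * μ G := by ring
      _ ≤ (4 * K ^ 2) ^ r * (L * σ) ^ r * μ G := by
          gcongr
          refine ENNReal.le_rpow_self_of_one_le ?_ hr
          calc (1 : ℝ≥0∞) ≤ 4 * 1 := by norm_num
            _ ≤ _ := by gcongr
      _ ≤ L ^ r * ∫⁻ x in hull Q ∪ hull B, ‖f x‖ₑ ^ r ∂μ := by
          rw [← ENNReal.mul_rpow_of_nonneg _ _ hr0.le]; exact hw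
      _ ≤ L ^ r * (σ ^ r * (K ^ 2 * μ B)) := by gcongr
      _ = (L * σ) ^ r * K ^ 2 * μ B := by
          rw [ENNReal.mul_rpow_of_nonneg _ _ hr0.le]; ring
  obtain ⟨y', hyB', hyE', hyG⟩ : ∃ y ∈ B, y ∉ E ∧ y ∉ G := by
    by_contra hcon
    push Not at hcon
    have hsub : B ⊆ (B ∩ E) ∪ G := fun x hx => by
      by_cases hxE : x ∈ E
      · exact Or.inl ⟨hx, hxE⟩
      · exact Or.inr (hcon x hx hxE)
    have h1 : μ B ≤ μ (B ∩ E) + μ G := (measure_mono hsub).trans (measure_union_le _ _)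
    have h2 : 3 * μ B + μ B ≤ 3 * μ B := by
      calc 3 * μ B + μ B = 4 * μ B := by ring
        _ ≤ 4 * (μ (B ∩ E) + μ G) := by gcongr
        _ = 2 * (2 * μ (B ∩ E)) + 4 * μ G := by ring
        _ ≤ 2 * μ B + μ B := by gcongr
        _ = 3 * μ B := by ring
    exact absurd h2 (not_le.2 (ENNReal.lt_add_right (by finiteness) hB0))
  set g := (hull Q)ᶜ.indicator f with hg
  have hgm : MemLp g (ENNReal.ofReal r) μ := hf.indicator hQm.compl
  have hgle : ∀ A ∈ ℬ, B ⊆ A → ballAvg μ r g A ≤ σ := fun A hA hBA =>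
    (ballAvg_mono hr fun x => enorm_indicator_le _ _ _).trans ((hout y hyE).2 A hA (hBA hyB))
  have e1 : g = (hull B \ hull Q).indicator f + (hull B)ᶜ.indicator g := by
    funext x
    by_cases hxB : x ∈ hull B <;> by_cases hxQ : x ∈ hull Q <;> simp [hg, hxB, hxQ]
  -- The far part becomes f minus a localized function, and both are controlled at the good point
  -- y'.
  have e2 : (hull B)ᶜ.indicator g = f - f' := by
    funext x
    by_cases hxB : x ∈ hull B <;> by_cases hxQ : x ∈ hull Q <;> simp [hg, hf', hxB, hxQ]
  have s1 : T g z ≤ T ((hull B \ hull Q).indicator f) z + T ((hull B)ᶜ.indicator g) z :=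
    hT.add_le' (hf.indicator (hBm.diff hQm)) (hgm.indicator hBm.compl) e1 z
  have s2 : T ((hull B)ᶜ.indicator g) z ≤ T ((hull B)ᶜ.indicator g) y' + L * σ :=
    localConst_osc_le h hr hL₁ hLtop hgm hB hgle (hQB.1 hz) hyB'
  have s3 : T ((hull B)ᶜ.indicator g) y' ≤ T f y' + T f' y' := hT.sub_le' hf hf'm e2 y'
  have s4 : T ((hull B \ hull Q).indicator f) z ≤ 2 * L * σ := by
    refine (hconn z hz f hf).trans ?_
    gcongr
    exact (hout y hyE).2 _ (h.hull_mem _ hB) (h.self_subset_hull hB hyB)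
  calc T g z ≤ 2 * L * σ + ((T f y' + T f' y') + L * σ) := by
        refine s1.trans (add_le_add s4 (s2.trans ?_)); gcongr
    _ ≤ 2 * L * σ + ((L * σ + 4 * K ^ 2 * (L * σ)) + L * σ) := by
        gcongr
        · exact (hout y' hyE').1
        · exact not_lt.1 hyG
    _ = 4 * 1 * (L * σ) + 4 * K ^ 2 * (L * σ) := by ring
    _ ≤ 4 * K ^ 2 * (L * σ) + 4 * K ^ 2 * (L * σ) := by gcongr
    _ = _ := by ring

end Operators

/-! ### Sparse domination -/

section Domination

variable {X 𝕜 : Type*} [MeasurableSpace X] [RCLike 𝕜] {μ : Measure X} {ℬ : Set (Set X)}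
  {hull : Set X → Set X} {K : ℝ≥0} {r : ℝ} {T : (X → 𝕜) → X → ℝ≥0∞} {f : X → 𝕜}

lemma ballAvg_eq_zero_of_ae (hr : 1 ≤ r) (hf : f =ᵐ[μ] 0) {B : Set X} (h0 : μ B ≠ 0)
    (htop : μ B ≠ ∞) : ballAvg μ r f B = 0 := by
  have hr0 : 0 < r := by positivity
  rw [← le_zero_iff, ballAvg_le_iff hr h0 htop]
  refine (setLIntegral_le_lintegral _ _).trans ?_
  have : ∫⁻ x, ‖f x‖ₑ ^ r ∂μ = ∫⁻ _, 0 ∂μ := lintegral_congr_ae (by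
    filter_upwards [hf] with x hx
    simp [hx, ENNReal.zero_rpow_of_pos hr0])
  rw [this, lintegral_zero]
  exact zero_le

/-- The factor 8K⁷ is 4K³ times 2K⁴, from 1 + K ≤ 2K and μ(H P) ≤ K³μ P. Since it is at least 1,
raising it to the power r only helps, so constants do not depend on r. -/
lemma measure_exceptionalSet_hull3_le (h : IsBallBasis μ ℬ hull K) (hK : 1 ≤ K) (hr : 1 ≤ r)
    (hT : IsSubadditive μ r T) {L : ℝ≥0∞} (hN : weakNorm μ r T ≤ L) (hL0 : L ≠ 0) (hLtop : L ≠ ∞)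
    (hf : MemLp f (ENNReal.ofReal r) μ) {P : Set X} (hP : P ∈ ℬ) :
    4 * K ^ 3 * μ (exceptionalSet μ ℬ r T L ((hull (hull (hull P))).indicator f)
      (8 * K ^ 7 * ballAvg μ r f (hull (hull (hull P))))) ≤ μ P := by
  have hr0 : 0 < r := by positivity
  have hK' : (1 : ℝ≥0∞) ≤ K := by exact_mod_cast hK
  have hHb := h.hull3_mem hP
  have hHle := h.measure_hull3_le hP
  set H := hull (hull (hull P)) with hH
  have hHm := h.measurableSet _ hHb
  set v := ballAvg μ r f H with hv
  have hvtop : v ≠ ∞ := ballAvg_ne_top hr hf (h.measure_ne_zero hHb)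
  have hfH : MemLp (H.indicator f) (ENNReal.ofReal r) μ := hf.indicator hHm
  have hI : ∫⁻ x, ‖H.indicator f x‖ₑ ^ r ∂μ = v ^ r * μ H := by
    rw [lintegral_indicator_rpow hr hHm, ballAvg_rpow_mul hr (h.measure_ne_zero hHb)
      (h.measure_ne_top hHb)]
  by_cases hv0 : v = 0
  · rw [hv0, ENNReal.zero_rpow_of_pos hr0, zero_mul] at hI
    have hz := ae_eq_zero_of_lintegral_eq_zero hr hfH hI
    have hempty : exceptionalSet μ ℬ r T L (H.indicator f) (8 * K ^ 7 * v) = ∅ := by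
      rw [exceptionalSet, union_empty_iff]
      constructor
      · ext x
        simp [hT.eq_zero_of_ae hfH hz x]
      · rw [sUnion_eq_empty]
        rintro B ⟨hB, hlt⟩
        rw [ballAvg_eq_zero_of_ae hr hz (h.measure_ne_zero hB) (h.measure_ne_top hB)] at hlt
        exact absurd hlt not_lt_zero
    simp [hempty]
  have hvr0 : v ^ r ≠ 0 := by simp [hv0, hvtop]
  have hvr : v ^ r ≠ ∞ := ENNReal.rpow_ne_top_of_nonneg hr0.le hvtop
  have hK7 : (1 : ℝ≥0∞) ≤ 8 * K ^ 7 := by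
    calc (1 : ℝ≥0∞) ≤ 8 * 1 := by norm_num
      _ ≤ _ := by gcongr; exact one_le_pow₀ hK'
  have hle := measure_exceptionalSet_le h hr hT hN hL0 hLtop hfH (σ := 8 * K ^ 7 * v)
    (mul_ne_zero (by positivity) hv0) (by finiteness)
  rw [hI] at hle
  set e := μ (exceptionalSet μ ℬ r T L (H.indicator f) (8 * K ^ 7 * v)) with he
  have hc0 : v ^ r * (2 * K ^ 4) ≠ 0 := mul_ne_zero hvr0 (by positivity)
  refine (ENNReal.mul_le_mul_iff_right hc0 (ENNReal.mul_ne_top hvr (by finiteness))).1 ?_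
  calc v ^ r * (2 * K ^ 4) * (4 * K ^ 3 * e) = 8 * K ^ 7 * v ^ r * e := by ring
    _ ≤ (8 * K ^ 7) ^ r * v ^ r * e := by
        gcongr; exact ENNReal.le_rpow_self_of_one_le hK7 hr
    _ = (8 * K ^ 7 * v) ^ r * e := by rw [ENNReal.mul_rpow_of_nonneg (8 * K ^ 7) v hr0.le]
    _ ≤ (1 + K) * (v ^ r * μ H) := hle
    _ ≤ (K + K) * (v ^ r * (K ^ 3 * μ P)) := by gcongr
    _ = v ^ r * (2 * K ^ 4) * μ P := by ring

lemma isSparse_empty (γ : ℝ≥0) : IsSparse μ γ ∅ :=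
  ⟨id, by simp, pairwiseDisjoint_empty⟩

lemma sparse_domination_of_pos (h : IsBallBasis μ ℬ hull K) (hK : 1 ≤ K) (hr : 1 ≤ r)
    (hT : IsSubadditive μ r T) {L : ℝ≥0∞} (hL₁ : localConst μ ℬ hull r T ≤ L)
    (hL₂ : connectConst μ ℬ hull r T ≤ L) (hN : weakNorm μ r T ≤ L) (hL0 : L ≠ 0) (hLtop : L ≠ ∞)
    (hf : MemLp f (ENNReal.ofReal r) μ) {B : Set X} (hB : B ∈ ℬ) :
    ∃ S ⊆ ℬ, IsSparse μ (2 * K ^ 3)⁻¹ S ∧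
      ∀ᵐ x ∂μ, x ∈ B → T f x ≤ 256 * K ^ 12 * L * sparseOp μ S r f x := by
  have hr0 : 0 < r := by positivity
  have hK' : (1 : ℝ≥0∞) ≤ K := by exact_mod_cast hK
  -- The root captures half the mass of |f|^r, so what lies off H A is handled by `far_bound`.
  obtain ⟨A, hA, hBA, hfA⟩ := h.exists_superset_lintegral_le (hf.lintegral_ne_top hr) hB
  set H : Set X → Set X := fun P => hull (hull (hull P)) with hH
  have hHb : ∀ P ∈ ℬ, H P ∈ ℬ := fun P hP => h.hull3_mem hP
  have hHm : ∀ P ∈ ℬ, MeasurableSet (H P) := fun P hP => h.measurableSet _ (hHb P hP)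
  set σ : Set X → ℝ≥0∞ := fun P => 8 * K ^ 7 * ballAvg μ r f (H P) with hσ
  have havg : ∀ P ∈ ℬ, ballAvg μ r f (H P) ≠ ∞ := fun P hP =>
    ballAvg_ne_top hr hf (h.measure_ne_zero (hHb P hP))
  set ex : Set X → Set X := fun P => exceptionalSet μ ℬ r T L ((H P).indicator f) (σ P) with hex
  set E : Set X → Set X := fun P => toMeasurable μ (ex P) with hEdef
  have hE : ∀ P ∈ ℬ, 4 * K ^ 3 * μ (E P) ≤ μ P := by
    intro P hP
    rw [hEdef, measure_toMeasurable]
    exact measure_exceptionalSet_hull3_le h hK hr hT hN hL0 hLtop hf hP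
  set c : ℝ≥0∞ := 64 * K ^ 9 * L with hc
  have hcσ : ∀ P, 8 * K ^ 2 * (L * σ P) = c * ballAvg μ r f (H P) := fun P => by
    simp only [hσ, hc]; ring
  have hfH : ∀ P ∈ ℬ, MemLp ((H P).indicator f) (ENNReal.ofReal r) μ := fun P hP =>
    hf.indicator (hHm P hP)
  have hone : (1 : ℝ≥0∞) ≤ 8 * K ^ 2 := by
    calc (1 : ℝ≥0∞) ≤ 8 * 1 := by norm_num
      _ ≤ _ := by gcongr; exact one_le_pow₀ hK'
  obtain ⟨S, hS, hAS, hdisj, hdom⟩ := h.exists_sparse_selection hK (E := E)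
    (a := fun P => c * ballAvg μ r f (H P)) (t := fun P => T ((H P).indicator f)) hE
    (fun P _ => measurableSet_toMeasurable _ _)
    (fun P hP => ENNReal.mul_ne_top (by finiteness) (havg P hP))
    (by
      intro P hP R hR hRP hdense z hz
      have e1 : (H P).indicator f = (H R)ᶜ.indicator ((H P).indicator f) + (H R).indicator f := by
        funext x
        by_cases hxR : x ∈ H R
        · simp [hxR, show x ∈ H P from hRP hxR]
        · simp [hxR]
      refine (hT.add_le' ((hfH P hP).indicator (hHm R hR).compl) (hfH R hR) e1 z).trans ?_
      gcongr
      -- `local_step` needs a positive threshold; for zero average the function vanishes almost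
      -- everywhere.
      by_cases hv0 : ballAvg μ r f (H P) = 0
      · have hI : ∫⁻ x, ‖(H P).indicator f x‖ₑ ^ r ∂μ = 0 := by
          rw [lintegral_indicator_rpow hr (hHm P hP), ← ballAvg_rpow_mul hr
            (h.measure_ne_zero (hHb P hP)) (h.measure_ne_top (hHb P hP)), hv0,
            ENNReal.zero_rpow_of_pos hr0, zero_mul]
        have hz := ae_eq_zero_of_lintegral_eq_zero hr (hfH P hP) hI
        rw [hT.eq_zero_of_ae ((hfH P hP).indicator (hHm R hR).compl) (by
          filter_upwards [hz] with x hx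
          by_cases hxR : x ∈ H R
          · simp [hxR]
          · rw [indicator_of_mem (show x ∈ (H R)ᶜ from hxR), hx])]
        exact zero_le
      · rw [← hcσ]
        exact local_step h hK hr hT hL₁ hL₂ hN hL0 hLtop (hfH P hP)
          (mul_ne_zero (by positivity) hv0) (ENNReal.mul_ne_top (by finiteness) (havg P hP))
          (subset_toMeasurable _ _) (h.hull_mem _ (h.hull_mem _ hR)) hdense hz)
    (by
      intro P hP z hz
      have hz' : z ∉ ex P := fun h' => hz (subset_toMeasurable _ _ h')
      have hle : T ((H P).indicator f) z ≤ L * σ P := not_lt.1 fun hlt => hz' (Or.inl hlt)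
      refine hle.trans ?_
      rw [← hcσ]
      exact le_mul_of_one_le_left zero_le hone) hA
  refine ⟨H '' S, ?_, h.isSparse_image_hull3 hK hE hS hdisj, ?_⟩
  · rintro _ ⟨P, hP, rfl⟩
    exact hHb P (hS hP)
  filter_upwards [hdom] with x hx hxB
  have hxA2 : x ∈ hull (hull A) := h.subset_hull2 hA (hBA hxB)
  have hxA3 : x ∈ H A := h.subset_hull3 hA (hBA hxB)
  have hfar : T ((H A)ᶜ.indicator f) x ≤ (L + L) * (2 * K ^ 3 * ballAvg μ r f (H A)) := by
    refine far_bound h hr hT hL₁ hLtop hN hf (h.hull_mem _ (h.hull_mem _ hA)) ?_ hxA2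
    have h2K : (1 : ℝ≥0∞) ≤ 2 * K ^ 3 := by
      calc (1 : ℝ≥0∞) ≤ 2 * 1 := by norm_num
        _ ≤ _ := by gcongr; exact one_le_pow₀ hK'
    calc ∫⁻ x, ‖f x‖ₑ ^ r ∂μ ≤ 2 * ∫⁻ x in A, ‖f x‖ₑ ^ r ∂μ := hfA
      _ ≤ 2 * ∫⁻ x in H A, ‖f x‖ₑ ^ r ∂μ := by
          gcongr 2 * ?_; exact lintegral_mono_set (h.subset_hull3 hA)
      _ = 2 * (ballAvg μ r f (H A) ^ r * μ (H A)) := by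
          rw [ballAvg_rpow_mul hr (h.measure_ne_zero (hHb A hA)) (h.measure_ne_top (hHb A hA))]
      _ ≤ 2 * (ballAvg μ r f (H A) ^ r * (K ^ 3 * μ A)) := by
          gcongr; exact h.measure_hull3_le hA
      _ = (2 * K ^ 3) * ballAvg μ r f (H A) ^ r * μ A := by ring
      _ ≤ (2 * K ^ 3) ^ r * ballAvg μ r f (H A) ^ r * μ (hull (hull A)) := by
          gcongr
          · exact ENNReal.le_rpow_self_of_one_le h2K hr
          · exact h.subset_hull2 hA
      _ = _ := by rw [ENNReal.mul_rpow_of_nonneg (2 * K ^ 3) _ hr0.le]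
  set W := hullSum hull (fun P => c * ballAvg μ r f (H P)) S x with hW
  have hAW : c * ballAvg μ r f (H A) ≤ W := by
    refine le_trans ?_ (hullSum_add_le _ (S := ∅) (empty_subset _) (notMem_empty _) hAS hxA3)
    exact le_add_self
  have hfar' : (L + L) * (2 * K ^ 3 * ballAvg μ r f (H A)) ≤ W := by
    refine le_trans ?_ hAW
    calc (L + L) * (2 * K ^ 3 * ballAvg μ r f (H A)) = 4 * K ^ 3 * L * ballAvg μ r f (H A) := by ring
      _ ≤ 64 * K ^ 9 * L * ballAvg μ r f (H A) := by
          gcongr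
          · norm_num
          · norm_num
  have e2 : f = (H A).indicator f + (H A)ᶜ.indicator f :=
    (indicator_self_add_compl _ _).symm
  calc T f x ≤ T ((H A).indicator f) x + T ((H A)ᶜ.indicator f) x :=
        hT.add_le' (hfH A hA) (hf.indicator (hHm A hA).compl) e2 x
    _ ≤ W + W := add_le_add (hx (h.self_subset_hull hA (hBA hxB))) (hfar.trans hfar')
    _ = 2 * W := (two_mul _).symm
    _ ≤ 2 * (2 * K ^ 3 * c * sparseOp μ (H '' S) r f x) := by
        gcongr; exact h.hullSum_le_sparseOp hK hE hS hdisj c r f x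
    _ = 256 * K ^ 12 * L * sparseOp μ (H '' S) r f x := by rw [hc]; ring

/-- Sparse domination of an operator whose constants are all at most `L`. -/
theorem exists_sparse_domination (h : IsBallBasis μ ℬ hull K) (hK : 1 ≤ K) (hr : 1 ≤ r)
    (hT : IsSubadditive μ r T) {L : ℝ≥0∞} (hL₁ : localConst μ ℬ hull r T ≤ L)
    (hL₂ : connectConst μ ℬ hull r T ≤ L) (hN : weakNorm μ r T ≤ L)
    (hf : MemLp f (ENNReal.ofReal r) μ) {B : Set X} (hB : B ∈ ℬ) :
    ∃ S ⊆ ℬ, IsSparse μ (2 * K ^ 3)⁻¹ S ∧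
      ∀ᵐ x ∂μ, x ∈ B → T f x ≤ 256 * K ^ 12 * L * sparseOp μ S r f x := by
  have hr0 : 0 < r := by positivity
  have hK0 : 0 < K := by positivity
  by_cases hL0 : L = 0
  · refine ⟨∅, empty_subset _, isSparse_empty _, ?_⟩
    have hnull : ∀ n : ℕ, ∀ᵐ x ∂μ, ¬ ((n : ℝ≥0∞) + 1)⁻¹ < T f x := by
      intro n
      have hw := weak_type_le hr hT hN hf (t := ((n : ℝ≥0∞) + 1)⁻¹)
        (ENNReal.inv_pos.2 (by finiteness)) (by simp)
      rw [hL0, ENNReal.zero_rpow_of_pos hr0, zero_mul, le_zero_iff, mul_eq_zero,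
        ENNReal.rpow_eq_zero_iff_of_pos hr0, ENNReal.inv_eq_zero] at hw
      rw [ae_iff]
      simpa only [not_not] using hw.resolve_left (by finiteness)
    filter_upwards [ae_all_iff.2 hnull] with x hx _
    have h0 : T f x = 0 := by
      by_contra hne
      obtain ⟨n, hn⟩ := ENNReal.exists_inv_nat_lt hne
      exact hx n ((ENNReal.inv_le_inv.2 (by simp)).trans_lt hn)
    rw [h0]
    exact zero_le
  -- The weak norm may be infinite; then one ball carrying half the mass gives an infinite bound,
  -- unless f vanishes almost everywhere.
  by_cases hLtop : L = ∞
  · obtain ⟨A, hA, hBA, hfA⟩ := h.exists_superset_lintegral_le (hf.lintegral_ne_top hr) hB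
    refine ⟨{A}, by simpa using hA, ⟨id, ?_, pairwiseDisjoint_singleton _ _⟩,
      Filter.Eventually.of_forall fun x hxB => ?_⟩
    · rintro _ rfl
      refine ⟨h.measurableSet _ hA, subset_rfl, ?_⟩
      refine mul_le_of_le_one_left zero_le ?_
      have : (2 * K ^ 3)⁻¹ ≤ 1 := by
        refine inv_le_one_of_one_le₀ ?_
        calc (1 : ℝ≥0) ≤ 2 * 1 := by norm_num
          _ ≤ _ := by gcongr; exact one_le_pow₀ hK
      exact_mod_cast this
    · by_cases h0 : ballAvg μ r f A = 0
      · have hI : ∫⁻ x, ‖f x‖ₑ ^ r ∂μ = 0 := by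
          rw [← ballAvg_rpow_mul hr (h.measure_ne_zero hA) (h.measure_ne_top hA), h0,
            ENNReal.zero_rpow_of_pos hr0, zero_mul, mul_zero] at hfA
          exact le_zero_iff.1 hfA
        rw [hT.eq_zero_of_ae hf (ae_eq_zero_of_lintegral_eq_zero hr hf hI)]
        exact zero_le
      · have hs : sparseOp μ {A} r f x ≠ 0 := by
          rw [sparseOp]
          refine (lt_of_lt_of_le (pos_iff_ne_zero.2 ?_)
            (ENNReal.le_tsum (⟨A, rfl⟩ : ({A} : Set (Set X))))).ne'
          rwa [indicator_of_mem (hBA hxB)]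
        rw [hLtop, ENNReal.mul_top (by positivity), ENNReal.top_mul hs]
        exact le_top
  exact sparse_domination_of_pos h hK hr hT hL₁ hL₂ hN hL0 hLtop hf hB

end Domination

/-! ### Suprema of operators -/

section Suprema

variable {X 𝕜 ι : Type*} [MeasurableSpace X] [RCLike 𝕜] {μ : Measure X} {ℬ : Set (Set X)}
  {hull : Set X → Set X} {K : ℝ≥0} {r : ℝ}

lemma IsSubadditive.supOp {V : Type*} [ENorm V] {T : ι → (X → 𝕜) → X → V}
    (hT : ∀ α, IsSubadditive μ r (T α)) : IsSubadditive μ r (supOp T) where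
  congr_ae f g hf hg hfg := by
    funext x
    exact iSup_congr fun α => by rw [(hT α).congr_ae f g hf hg hfg]
  smul c f hf x := by
    simp only [_root_.supOp, enorm_eq_self, ENNReal.mul_iSup]
    exact iSup_congr fun α => (hT α).smul c f hf x
  add_le f g hf hg x := by
    simp only [_root_.supOp, enorm_eq_self]
    exact iSup_le fun α => ((hT α).add_le f g hf hg x).trans
      (add_le_add (le_iSup (fun α => ‖T α f x‖ₑ) α) (le_iSup (fun α => ‖T α g x‖ₑ) α))

lemma IsSubadditive.enorm {V : Type*} [ENorm V] {T : (X → 𝕜) → X → V}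
    (hT : IsSubadditive μ r T) : IsSubadditive μ r fun f x => ‖T f x‖ₑ where
  congr_ae f g hf hg hfg := by
    funext x
    rw [hT.congr_ae f g hf hg hfg]
  smul := hT.smul
  add_le := hT.add_le

lemma localConst_enorm_le (T : (X → 𝕜) → X → 𝕜) :
    localConst μ ℬ hull r (fun f x => ‖T f x‖ₑ) ≤ localConst μ ℬ hull r T :=
  iSup₂_mono fun _ _ => iSup₂_mono fun _ _ => iSup₂_mono fun _ _ => iSup₂_mono fun _ _ =>
    ENNReal.div_le_div_right (ENNReal.edist_enorm_le _ _) _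

variable {T : ι → (X → 𝕜) → X → ℝ≥0∞} {L N M : ℝ≥0∞}

lemma localConst_supOp_le (h : IsBallBasis μ ℬ hull K) (hr : 1 ≤ r)
    (hL : ∀ α, localConst μ ℬ hull r (T α) ≤ L) (hLtop : L ≠ ∞) :
    localConst μ ℬ hull r (supOp T) ≤ L := by
  refine iSup₂_le fun B hB => iSup₂_le fun x hx => iSup₂_le fun x' hx' => iSup₂_le fun f hf => ?_
  refine ENNReal.div_le_of_le_mul ?_
  have key : ∀ y ∈ B, ∀ y' ∈ B, supOp T ((hull B)ᶜ.indicator f) y ≤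
      supOp T ((hull B)ᶜ.indicator f) y' + L * ballAvgStar μ ℬ r f B := by
    intro y hy y' hy'
    refine iSup_le fun α => ?_
    refine (ENNReal.le_add_edist _ (T α ((hull B)ᶜ.indicator f) y')).trans (add_le_add ?_ ?_)
    · exact le_iSup (fun α => ‖T α ((hull B)ᶜ.indicator f) y'‖ₑ) α
    · exact localConst_osc h hr (hL α) hLtop hf hB hy hy'
  exact ENNReal.edist_le_of_le_add (key x hx x' hx') (key x' hx' x hx)

/-- A ball joining A to a point off hull A must be more than twice as large as A, so its hull
contains A. This covers the empty index family, which supplies no connecting ball. -/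
lemma IsBallBasis.exists_ssuperset (h : IsBallBasis μ ℬ hull K) {A : Set X} (hA : A ∈ ℬ)
    (hne : hull A ≠ univ) : ∃ B ∈ ℬ, A ⊂ B := by
  obtain ⟨x, hx⟩ := h.nonempty_ball hA
  obtain ⟨y, hy⟩ := (ne_univ_iff_exists_notMem _).1 hne
  obtain ⟨D, hD, hxD, hyD⟩ := h.exists_mem_mem x y
  have hlt : 2 * μ A < μ D := by
    by_contra hcon
    exact hy (h.subset_hull_of_inter hD hA (not_lt.1 hcon) ⟨x, hxD, hx⟩ hyD)
  have hle : μ A ≤ 2 * μ D := by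
    refine le_trans (le_trans ?_ hlt.le) ?_ <;> rw [two_mul] <;> exact le_self_add
  exact ⟨hull D, h.hull_mem _ hD, h.subset_hull_of_inter hA hD hle ⟨x, hx, hxD⟩,
    fun hsub => hy (h.self_subset_hull hA (hsub (h.self_subset_hull hD hyD)))⟩

/-- A single ball connects `A` for all the operators at once. -/
lemma connectConst_supOp_le_of_lt (h : IsBallBasis μ ℬ hull K) (hK : 1 ≤ K) (hr : 1 ≤ r)
    (hT : ∀ α, IsSubadditive μ r (T α)) (hL : ∀ α, localConst μ ℬ hull r (T α) ≤ L)
    (hLtop : L ≠ ∞) (hM : ∀ α, connectConst μ ℬ hull r (T α) < M) (hMtop : M ≠ ∞)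
    (hN : ∀ α, weakNorm μ r (T α) ≤ N) :
    connectConst μ ℬ hull r (supOp T) ≤ 2 * K * (L + M + N) := by
  refine sInf_le fun A hA hne => ?_
  choose B hB hAB hconn using fun α => exists_connecting_ball h hr (hM α) hMtop hA hne
  -- The infimum of the measures is positive because every B α contains A, so some B α is within a
  -- factor 2 of it.
  obtain ⟨D, hD, hAD, hDB⟩ : ∃ D ∈ ℬ, A ⊂ D ∧ ∀ α, μ D ≤ 2 * μ (B α) := by
    rcases isEmpty_or_nonempty ι with hι | hι
    · obtain ⟨D, hD, hAD⟩ := h.exists_ssuperset hA hne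
      exact ⟨D, hD, hAD, fun α => hι.elim α⟩
    · set m := ⨅ α, μ (B α) with hm
      have hm0 : m ≠ 0 := (lt_of_lt_of_le (h.measure_pos A hA)
        (le_iInf fun α => measure_mono (hAB α).1)).ne'
      have hmtop : m ≠ ∞ :=
        ne_top_of_le_ne_top (h.measure_ne_top (hB hι.some)) (iInf_le _ hι.some)
      obtain ⟨α, hα⟩ := iInf_lt_iff.1 (show m < 2 * m by
        rw [two_mul]; exact ENNReal.lt_add_right hmtop hm0)
      exact ⟨B α, hB α, hAB α, fun β => hα.le.trans (by gcongr; exact iInf_le _ β)⟩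
  refine ⟨D, hD, hAD, iSup₂_le fun x hx => iSup₂_le fun f hf => ENNReal.div_le_of_le_mul ?_⟩
  refine iSup_le fun α => ?_
  have hK' : (1 : ℝ≥0∞) ≤ K := by exact_mod_cast hK
  have h2K : (1 : ℝ≥0∞) ≤ 2 * K := by
    calc (1 : ℝ≥0∞) ≤ 2 * 1 := by norm_num
      _ ≤ _ := by gcongr
  have hr0 : 0 < r := by positivity
  have hAm := h.measurableSet _ (h.hull_mem _ hA)
  have hD' := h.hull_mem _ hD
  have hDm := h.measurableSet _ hD'
  have hB' := h.hull_mem _ (hB α)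
  have hBm := h.measurableSet _ hB'
  set φ := (hull D \ hull A).indicator f with hφ
  have hφm : MemLp φ (ENNReal.ofReal r) μ := hf.indicator (hDm.diff hAm)
  have hI : ∫⁻ x, ‖φ x‖ₑ ^ r ∂μ ≤ (2 * K * ballAvg μ r f (hull D)) ^ r * μ (B α) := by
    calc ∫⁻ x, ‖φ x‖ₑ ^ r ∂μ ≤ ∫⁻ x in hull D, ‖f x‖ₑ ^ r ∂μ := by
          rw [lintegral_indicator_rpow hr (hDm.diff hAm)]
          exact lintegral_mono_set sdiff_subset
      _ = ballAvg μ r f (hull D) ^ r * μ (hull D) :=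
          (ballAvg_rpow_mul hr (h.measure_ne_zero hD') (h.measure_ne_top hD')).symm
      _ ≤ ballAvg μ r f (hull D) ^ r * (K * (2 * μ (B α))) := by
          gcongr
          exact (h.measure_hull_le _ hD).trans (by gcongr; exact hDB α)
      _ = (2 * K) * ballAvg μ r f (hull D) ^ r * μ (B α) := by ring
      _ ≤ (2 * K) ^ r * ballAvg μ r f (hull D) ^ r * μ (B α) := by
          gcongr; exact ENNReal.le_rpow_self_of_one_le h2K hr
      _ = _ := by rw [ENNReal.mul_rpow_of_nonneg (2 * K) _ hr0.le]
  -- The piece inside hull (B α) is the connectivity term of α; the remainder is far from B α and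
  -- has small total mass.
  have e1 : φ = (hull (B α) \ hull A).indicator φ + (hull (B α))ᶜ.indicator φ := by
    funext y
    by_cases hyB : y ∈ hull (B α) <;> by_cases hyA : y ∈ hull A <;> simp [hφ, hyB, hyA]
  have s1 : T α ((hull (B α) \ hull A).indicator φ) x ≤ M * (2 * K * ballAvg μ r f (hull D)) := by
    refine (hconn α x hx φ hφm).trans ?_
    gcongr
    exact ballAvg_le_of_lintegral_le hr (h.measure_ne_zero (hB α)) (h.self_subset_hull (hB α))
      (h.measure_ne_top hB') hI
  have s2 : T α ((hull (B α))ᶜ.indicator φ) x ≤ (L + N) * (2 * K * ballAvg μ r f (hull D)) :=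
    far_bound h hr (hT α) (hL α) hLtop (hN α) hφm (hB α) hI ((hAB α).1 hx)
  calc T α φ x ≤ T α ((hull (B α) \ hull A).indicator φ) x + T α ((hull (B α))ᶜ.indicator φ) x :=
        (hT α).add_le' (hφm.indicator (hBm.diff hAm)) (hφm.indicator hBm.compl) e1 x
    _ ≤ M * (2 * K * ballAvg μ r f (hull D)) + (L + N) * (2 * K * ballAvg μ r f (hull D)) :=
        add_le_add s1 s2
    _ = _ := by ring

lemma connectConst_supOp_le (h : IsBallBasis μ ℬ hull K) (hK : 1 ≤ K) (hr : 1 ≤ r)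
    (hT : ∀ α, IsSubadditive μ r (T α)) (hL : ∀ α, localConst μ ℬ hull r (T α) ≤ L)
    (hLtop : L ≠ ∞) (hM : ∀ α, connectConst μ ℬ hull r (T α) ≤ M) (hMtop : M ≠ ∞)
    (hN : ∀ α, weakNorm μ r (T α) ≤ N) :
    connectConst μ ℬ hull r (supOp T) ≤ 2 * K * (L + M + N) := by
  have hK0 : 0 < K := by positivity
  refine ENNReal.le_of_forall_pos_le_add fun ε hε _ => ?_
  have hε' : (ε : ℝ≥0∞) / (2 * K) ≠ 0 :=
    (ENNReal.div_pos (by exact_mod_cast hε.ne') (by finiteness)).ne'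
  have hεtop : (ε : ℝ≥0∞) / (2 * K) ≠ ∞ := ENNReal.div_ne_top (by simp) (by positivity)
  refine (connectConst_supOp_le_of_lt h hK hr hT hL hLtop (M := M + ε / (2 * K))
    (fun α => (hM α).trans_lt (ENNReal.lt_add_right hMtop hε')) (by finiteness) hN).trans ?_
  rw [show L + (M + ε / (2 * K)) + N = (L + M + N) + (ε : ℝ≥0∞) / (2 * K) by ring, mul_add,
    ENNReal.mul_div_cancel (by positivity) (by finiteness)]

end Suprema

/-! ### Maximal modulations -/

section Modulation

variable {X 𝕜 ι : Type*} [MeasurableSpace X] [RCLike 𝕜] {μ : Measure X} {ℬ : Set (Set X)}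
  {hull : Set X → Set X} {K : ℝ≥0} {r : ℝ} {T : (X → 𝕜) → X → 𝕜} {G L M : ℝ≥0∞}

omit [MeasurableSpace X] in
lemma mul_indicator_eq (s : Set X) (g f : X → 𝕜) :
    g * s.indicator f = s.indicator (g * f) := by
  funext x
  by_cases hx : x ∈ s <;> simp [hx]

lemma memLp_mul {g f : X → 𝕜} (hg : MemLp g ∞ μ) (hf : MemLp f (ENNReal.ofReal r) μ) :
    MemLp (g * f) (ENNReal.ofReal r) μ :=
  hf.mul hg

lemma ballAvg_mul_le (hr : 1 ≤ r) {g : X → 𝕜} (hG : eLpNorm g ∞ μ ≤ G)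
    (hGtop : G ≠ ∞) (f : X → 𝕜) {B : Set X}
    (h0 : μ B ≠ 0) (htop : μ B ≠ ∞) : ballAvg μ r (g * f) B ≤ G * ballAvg μ r f B := by
  have hr0 : 0 < r := by positivity
  rw [ballAvg_le_iff hr h0 htop, ENNReal.mul_rpow_of_nonneg _ _ hr0.le, mul_assoc,
    ballAvg_rpow_mul hr h0 htop]
  rw [← lintegral_const_mul' _ _ (ENNReal.rpow_ne_top_of_nonneg hr0.le hGtop)]
  refine lintegral_mono_ae (ae_restrict_of_ae ?_)
  rw [eLpNorm_exponent_top] at hG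
  filter_upwards [ae_le_eLpNormEssSup (f := g) (μ := μ)] with x hx
  rw [← ENNReal.mul_rpow_of_nonneg _ _ hr0.le, Pi.mul_apply, enorm_mul]
  gcongr
  exact hx.trans hG

lemma IsSubadditive.modulation (hT : IsSubadditive μ r T) {g : X → 𝕜} (hg : MemLp g ∞ μ) :
    IsSubadditive μ r fun f => T (g * f) where
  congr_ae f₁ f₂ h₁ h₂ hf := hT.congr_ae _ _ (memLp_mul hg h₁) (memLp_mul hg h₂)
    (hf.mono fun x hx => by simp [hx])
  smul c f hf x := by
    rw [show g * c • f = c • (g * f) from mul_smul_comm c g f]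
    exact hT.smul c _ (memLp_mul hg hf) x
  add_le f₁ f₂ h₁ h₂ x := by
    rw [mul_add]
    exact hT.add_le _ _ (memLp_mul hg h₁) (memLp_mul hg h₂) x

lemma localConst_modulation_le (h : IsBallBasis μ ℬ hull K) (hr : 1 ≤ r)
    (hL : localConst μ ℬ hull r T ≤ L) (hLtop : L ≠ ∞) {g : X → 𝕜} (hg : MemLp g ∞ μ)
    (hG : eLpNorm g ∞ μ ≤ G) (hGtop : G ≠ ∞) :
    localConst μ ℬ hull r (fun f x => ‖T (g * f) x‖ₑ) ≤ G * L := by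
  refine iSup₂_le fun B hB => iSup₂_le fun x hx => iSup₂_le fun x' hx' => iSup₂_le fun f hf => ?_
  refine ENNReal.div_le_of_le_mul ?_
  beta_reduce
  rw [mul_indicator_eq]
  refine (localConst_osc h hr ((localConst_enorm_le T).trans hL) hLtop (memLp_mul hg hf) hB hx
    hx').trans ?_
  rw [mul_comm G L, mul_assoc]
  gcongr
  exact ballAvgStar_le fun A hA hBA =>
    (ballAvg_mul_le hr hG hGtop f (h.measure_ne_zero hA) (h.measure_ne_top hA)).trans
      (by gcongr; exact le_iSup₂_of_le A ⟨hA, hBA⟩ le_rfl)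

/-- The ball B is chosen for T before the index α, so no weak-type bound is required, unlike for a
general supremum. -/
lemma connectConst_maxModulation_le_of_lt (h : IsBallBasis μ ℬ hull K) (hr : 1 ≤ r)
    (hM : connectConst μ ℬ hull r T < M) (hMtop : M ≠ ∞) {g : ι → X → 𝕜}
    (hg : ∀ α, MemLp (g α) ∞ μ) (hG : ∀ α, eLpNorm (g α) ∞ μ ≤ G) (hGtop : G ≠ ∞) :
    connectConst μ ℬ hull r (maxModulation g T) ≤ G * M := by
  refine sInf_le fun A hA hne => ?_
  obtain ⟨B, hB, hAB, hconn⟩ := exists_connecting_ball (T := fun f x => ‖T f x‖ₑ) h hr hM hMtop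
    hA hne
  refine ⟨B, hB, hAB, iSup₂_le fun x hx => iSup₂_le fun f hf => ENNReal.div_le_of_le_mul ?_⟩
  refine iSup_le fun α => ?_
  have hB' := h.hull_mem _ hB
  beta_reduce
  rw [mul_indicator_eq]
  refine (hconn x hx _ (memLp_mul (hg α) hf)).trans ?_
  rw [mul_comm G M, mul_assoc]
  gcongr
  exact ballAvg_mul_le hr (hG α) hGtop f (h.measure_ne_zero hB') (h.measure_ne_top hB')

lemma connectConst_maxModulation_le (h : IsBallBasis μ ℬ hull K) (hr : 1 ≤ r)
    (hM : connectConst μ ℬ hull r T ≤ M) (hMtop : M ≠ ∞) {g : ι → X → 𝕜}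
    (hg : ∀ α, MemLp (g α) ∞ μ) (hG : ∀ α, eLpNorm (g α) ∞ μ ≤ G) (hGtop : G ≠ ∞) :
    connectConst μ ℬ hull r (maxModulation g T) ≤ G * M := by
  refine ENNReal.le_of_forall_pos_le_add fun ε hε _ => ?_
  -- G may vanish, hence the denominator G + 1.
  have hε' : (ε : ℝ≥0∞) / (G + 1) ≠ 0 :=
    (ENNReal.div_pos (by exact_mod_cast hε.ne') (by finiteness)).ne'
  have hεtop : (ε : ℝ≥0∞) / (G + 1) ≠ ∞ := ENNReal.div_ne_top (by simp) (by simp)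
  refine (connectConst_maxModulation_le_of_lt h hr (M := M + ε / (G + 1))
    (hM.trans_lt (ENNReal.lt_add_right hMtop hε')) (by finiteness) hg hG hGtop).trans ?_
  rw [mul_add]
  gcongr
  calc G * (ε / (G + 1)) ≤ (G + 1) * (ε / (G + 1)) := by gcongr; exact le_self_add
    _ = ε := ENNReal.mul_div_cancel (by simp) (by finiteness)

end Modulation

/-! ### The main theorem -/

theorem mainTheorem11 (K : ℝ≥0) :
    ∃ C γ : ℝ≥0, 0 < C ∧ 0 < γ ∧ γ < 1 ∧
      ∀ (𝕜 : Type*) [RCLike 𝕜] (X : Type*) [MeasurableSpace X] (μ : Measure X)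
        (ℬ : Set (Set X)) (hull : Set X → Set X) (_ : IsBallBasis μ ℬ hull K)
        (r : ℝ) (_ : 1 ≤ r) (ι : Type*),
        (∀ T : ι → (X → 𝕜) → X → 𝕜,
          (∀ α, IsBO μ ℬ hull r (T α)) →
          (⨆ α, localConst μ ℬ hull r (T α)) < ∞ →
          (⨆ α, connectConst μ ℬ hull r (T α)) < ∞ →
          (⨆ α, weakNorm μ r (T α)) < ∞ →
          IsBO μ ℬ hull r (supOp T) ∧
          localConst μ ℬ hull r (supOp T) ≤ C * ⨆ α, localConst μ ℬ hull r (T α) ∧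
          connectConst μ ℬ hull r (supOp T) ≤
            C * ((⨆ α, localConst μ ℬ hull r (T α)) + (⨆ α, connectConst μ ℬ hull r (T α)) +
              ⨆ α, weakNorm μ r (T α))) ∧
        (∀ (T : (X → 𝕜) → X → 𝕜) (g : ι → X → 𝕜),
          IsBO μ ℬ hull r T →
          weakNorm μ r T < ∞ →
          (∀ α, MemLp (g α) ∞ μ) →
          (⨆ α, eLpNorm (g α) ∞ μ) < ∞ →
          IsBO μ ℬ hull r (maxModulation g T) ∧
          ∀ f : X → 𝕜, MemLp f (ENNReal.ofReal r) μ → ∀ B ∈ ℬ,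
            ∃ 𝒮₁ 𝒮₂ : Set (Set X), 𝒮₁ ⊆ ℬ ∧ 𝒮₂ ⊆ ℬ ∧ IsSparse μ γ 𝒮₁ ∧ IsSparse μ γ 𝒮₂ ∧
              ∀ᵐ x ∂μ, x ∈ B →
                maxModulation g T f x ≤
                  C * ((⨆ α, eLpNorm (g α) ∞ μ) *
                        (localConst μ ℬ hull r T + connectConst μ ℬ hull r T) +
                      weakNorm μ r (maxModulation g T)) *
                    sparseOp μ (𝒮₁ ∪ 𝒮₂) r f x) := by
  -- K is not assumed to be at least 1; enlarging it preserves the ball-basis axioms.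
  have hK1 : (1 : ℝ≥0) ≤ max K 1 := le_max_right _ _
  have hK0 : (0 : ℝ≥0) < max K 1 := by positivity
  have hpow : ∀ n : ℕ, (1 : ℝ≥0) ≤ max K 1 ^ n := fun n => one_le_pow₀ hK1
  refine ⟨256 * max K 1 ^ 12, (2 * max K 1 ^ 3)⁻¹, by positivity, by positivity, ?_, ?_⟩
  · refine inv_lt_one_of_one_lt₀ ?_
    calc (1 : ℝ≥0) < 2 * 1 := by norm_num
      _ ≤ _ := by gcongr; exact hpow 3
  intro 𝕜 _ X _ μ ℬ hull h' r hr ι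
  have h : IsBallBasis μ ℬ hull (max K 1) := h'.mono_const (le_max_left _ _)
  constructor
  · intro T hT hL hM hN
    have hL' : localConst μ ℬ hull r (supOp T) ≤ ⨆ α, localConst μ ℬ hull r (T α) :=
      localConst_supOp_le (T := fun α f x => ‖T α f x‖ₑ) h hr
        (fun α => (localConst_enorm_le (T α)).trans
          (le_iSup (fun α => localConst μ ℬ hull r (T α)) α)) hL.ne
    have hM' : connectConst μ ℬ hull r (supOp T) ≤
        2 * (max K 1 : ℝ≥0) * ((⨆ α, localConst μ ℬ hull r (T α)) +
          (⨆ α, connectConst μ ℬ hull r (T α)) + ⨆ α, weakNorm μ r (T α)) :=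
      connectConst_supOp_le (T := fun α f x => ‖T α f x‖ₑ) h hK1 hr
        (fun α => (hT α).subadditive.enorm)
        (fun α => (localConst_enorm_le (T α)).trans
          (le_iSup (fun α => localConst μ ℬ hull r (T α)) α)) hL.ne
        (fun α => le_iSup (fun α => connectConst μ ℬ hull r (T α)) α) hM.ne
        (fun α => le_iSup (fun α => weakNorm μ r (T α)) α)
    refine ⟨⟨IsSubadditive.supOp fun α => (hT α).subadditive, hL'.trans_lt hL,
      hM'.trans_lt (by finiteness)⟩, hL'.trans ?_, hM'.trans ?_⟩
    · refine le_mul_of_one_le_left zero_le ?_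
      have : (1 : ℝ≥0) ≤ 256 * max K 1 ^ 12 := by
        calc (1 : ℝ≥0) ≤ 256 * 1 := by norm_num
          _ ≤ _ := by gcongr; exact hpow 12
      exact_mod_cast this
    · gcongr
      have : 2 * max K 1 ≤ 256 * max K 1 ^ 12 := by
        gcongr
        · norm_num
        · exact le_self_pow₀ hK1 (by norm_num)
      exact_mod_cast this
  · intro T g hT hN hg hG
    have hle : ∀ α, eLpNorm (g α) ∞ μ ≤ ⨆ α, eLpNorm (g α) ∞ μ :=
      fun α => le_iSup (fun α => eLpNorm (g α) ∞ μ) α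
    have hsub : IsSubadditive μ r (maxModulation g T) :=
      IsSubadditive.supOp fun α => hT.subadditive.modulation (hg α)
    have hLtop := hT.localization
    have hMtop := hT.connectivity
    have hL' : localConst μ ℬ hull r (maxModulation g T) ≤
        (⨆ α, eLpNorm (g α) ∞ μ) * localConst μ ℬ hull r T :=
      localConst_supOp_le (T := fun α f x => ‖T (g α * f) x‖ₑ) h hr
        (fun α => localConst_modulation_le h hr le_rfl hLtop.ne (hg α) (hle α) hG.ne)
        (by finiteness)
    have hM' : connectConst μ ℬ hull r (maxModulation g T) ≤
        (⨆ α, eLpNorm (g α) ∞ μ) * connectConst μ ℬ hull r T :=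
      connectConst_maxModulation_le h hr le_rfl hMtop.ne hg hle hG.ne
    refine ⟨⟨hsub, hL'.trans_lt (by finiteness), hM'.trans_lt (by finiteness)⟩, ?_⟩
    intro f hf B hB
    obtain ⟨S, hS, hSs, hae⟩ := exists_sparse_domination h hK1 hr hsub
      (L := (⨆ α, eLpNorm (g α) ∞ μ) * (localConst μ ℬ hull r T + connectConst μ ℬ hull r T) +
        weakNorm μ r (maxModulation g T))
      (hL'.trans (by rw [mul_add, add_assoc]; exact le_self_add))
      (hM'.trans (by rw [mul_add]; exact le_add_right le_add_self)) le_add_self hf hB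
    -- One sparse collection already suffices, so it is used twice.
    refine ⟨S, S, hS, hS, hSs, hSs, ?_⟩
    rw [union_self]
    push_cast at hae ⊢
    exact hae
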